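/- Let $\gamma,\mu,\lambda>0$, let $\omega^*=\frac{4}{\gamma^2}\frac{\mu+1}{\mu}$, and let $\omega>\omega^*$. Let $H_\gamma$ be the operator in $L^2(\mathbb R;\mathbb C)$ acting as $H_\gamma u=-u''$ away from the origin on the domain $$D(H_\gamma)=\{u\in H^2(\mathbb R\setminus\{0\}) : u'(0+)=u'(0-),\ u(0+)-u(0-)=-\gamma\,u'(0+)\}.$$ Then the system $$t_1^{2\mu}-t_1^{2\mu+2}=t_2^{2\mu}-t_2^{2\mu+2},\qquad t_1^{-1}+t_2^{-1}=\gamma\sqrt\omega$$ has exactly one solution $(t_1,t_2)$ with $0<t_1<t_2$ (and then $t_2<1$). Put $y_j=\frac{1}{2\mu\sqrt\omega}\log\left|\frac{1+t_j}{1-t_j}\right|$ (so that $\tanh(\mu\sqrt\omega\,y_j)=t_j$), and for $\theta\in\mathbb R$ let $$\psi(x)=\psi_\omega^{y_1,-y_2,\theta}(x)=\begin{cases}-e^{i\theta}\phi(x-y_1),&x<0,\\ e^{i\theta}\phi(x+y_2),&x>0,\end{cases}\qquad \phi(x)=\lambda^{-\frac1{2\mu}}(\mu+1)^{\frac1{2\mu}}\omega^{\frac1{2\mu}}\operatorname{sech}^{\frac1\mu}(\mu\sqrt\omega\,x).$$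 Consider the operator $$L_1u=H_\gamma u+\omega u-(2\mu+1)\lambda|\psi|^{2\mu}u,\qquad D(L_1)=D(H_\gamma),$$ in $L^2(\mathbb R;\mathbb C)$; equivalently, the potential term is $-\frac{\omega(\mu+1)(2\mu+1)}{\cosh^2(\mu\sqrt\omega(x-y_1))}$ for $x<0$ and $-\frac{\omega(\mu+1)(2\mu+1)}{\cosh^2(\mu\sqrt\omega(x+y_2))}$ for $x>0$. Then $L_1$ has trivial kernel, and it has exactly one negative eigenvalue, which is simple (its eigenspace has dimension one). -/

import Mathlib

open MeasureTheory Filter Topology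
open scoped ENNReal

noncomputable section

/-- The Hilbert space `L²(ℝ; ℂ)`. -/
abbrev L2 : Type := Lp ℂ 2 (volume : Measure ℝ)

/-! ### Sobolev functions on `ℝ ∖ {0}` -/

/-- `g` is the weak derivative of `f` on `ℝ ∖ {0}`: integration by parts holds against every smooth
test function whose support is a compact subset of `ℝ ∖ {0}`. -/
def IsWeakDeriv (f g : L2) : Prop :=
  ∀ φ : ℝ → ℝ, ContDiff ℝ ((⊤ : ℕ∞) : WithTop ℕ∞) φ → HasCompactSupport φ → tsupport φ ⊆ {0}ᶜ →
    ∫ x, deriv φ x • f x = -∫ x, φ x • g x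

/-- `a` is the one-sided limit `f (0+)` of the class `f`: the limit at `0` from the right, null sets
being disregarded (for a class with a representative that is continuous on `(0, ∞)`
this is the limit of that representative). -/
def HasRightTrace (f : L2) (a : ℂ) : Prop :=
  Tendsto f (𝓝[>] 0 ⊓ ae volume) (𝓝 a)

/-- `a` is the one-sided limit `f (0-)` of the class `f`, null sets being disregarded. -/
def HasLeftTrace (f : L2) (a : ℂ) : Prop :=
  Tendsto f (𝓝[<] 0 ⊓ ae volume) (𝓝 a)

/-- `u ∈ H²(ℝ ∖ {0})` with weak derivatives `u'` and `u''` in `L²`. -/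
structure IsH2With (u u' u'' : L2) : Prop where
  first : IsWeakDeriv u u'
  second : IsWeakDeriv u' u''

/-- The boundary conditions of the `δ'` interaction of strength `γ` at the origin:
`u'(0+) = u'(0-)` and `u(0+) - u(0-) = -γ u'(0+)`. -/
def DeltaPrimeCondition (γ : ℝ) (u u' : L2) : Prop :=
  ∃ a b d : ℂ, HasRightTrace u a ∧ HasLeftTrace u b ∧ HasRightTrace u' d ∧ HasLeftTrace u' d ∧
    a - b = -(γ : ℂ) * d

/-! ### Facts needed for the operator to be well defined -/

theorem integrable_test_smul (f : L2) {φ : ℝ → ℝ} (hφ : Continuous φ) (hc : HasCompactSupport φ) :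
    Integrable (fun x => φ x • f x) :=
  ((Lp.memLp f).locallyIntegrable (by norm_num)).integrable_smul_left_of_hasCompactSupport hφ hc

theorem IsWeakDeriv.add {f g f₁ g₁ : L2} (h : IsWeakDeriv f g) (h₁ : IsWeakDeriv f₁ g₁) :
    IsWeakDeriv (f + f₁) (g + g₁) := by
  intro φ hφ hc hs
  have hd : Continuous (deriv φ) := hφ.continuous_deriv (by simp)
  have e1 : ∫ x, deriv φ x • (f + f₁ : L2) x
      = ∫ x, (deriv φ x • f x + deriv φ x • f₁ x) := by
    refine integral_congr_ae ?_
    filter_upwards [Lp.coeFn_add f f₁] with x hx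
    rw [hx, Pi.add_apply, smul_add]
  have e2 : ∫ x, φ x • (g + g₁ : L2) x = ∫ x, (φ x • g x + φ x • g₁ x) := by
    refine integral_congr_ae ?_
    filter_upwards [Lp.coeFn_add g g₁] with x hx
    rw [hx, Pi.add_apply, smul_add]
  rw [e1, e2, integral_add (integrable_test_smul f hd hc.deriv)
    (integrable_test_smul f₁ hd hc.deriv), integral_add (integrable_test_smul g hφ.continuous hc)
    (integrable_test_smul g₁ hφ.continuous hc), h φ hφ hc hs, h₁ φ hφ hc hs]
  ring

theorem IsWeakDeriv.const_smul {f g : L2} (h : IsWeakDeriv f g) (c : ℂ) :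
    IsWeakDeriv (c • f) (c • g) := by
  intro φ hφ hc hs
  have e1 : ∫ x, deriv φ x • (c • f : L2) x = ∫ x, c • (deriv φ x • f x) := by
    refine integral_congr_ae ?_
    filter_upwards [Lp.coeFn_smul c f] with x hx
    simp [hx, mul_left_comm]
  have e2 : ∫ x, φ x • (c • g : L2) x = ∫ x, c • (φ x • g x) := by
    refine integral_congr_ae ?_
    filter_upwards [Lp.coeFn_smul c g] with x hx
    simp [hx, mul_left_comm]
  rw [e1, e2, integral_smul, integral_smul, h φ hφ hc hs, smul_neg]

theorem isWeakDeriv_zero : IsWeakDeriv 0 0 := by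
  intro φ hφ hc hs
  have e : ∀ χ : ℝ → ℝ, ∫ x, χ x • (0 : L2) x = 0 := fun χ => by
    refine integral_eq_zero_of_ae ?_
    filter_upwards [Lp.coeFn_zero ℂ 2 (volume : Measure ℝ)] with x hx
    rw [hx, Pi.zero_apply, smul_zero]
  rw [e, e, neg_zero]

/-- Weak derivatives are unique. -/
theorem IsWeakDeriv.unique {f g g₁ : L2} (h : IsWeakDeriv f g) (h₁ : IsWeakDeriv f g₁) :
    g = g₁ := by
  have hl : LocallyIntegrable (fun x => g x - g₁ x) :=
    ((Lp.memLp g).locallyIntegrable (by norm_num)).sub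
      ((Lp.memLp g₁).locallyIntegrable (by norm_num))
  have key := (isOpen_compl_singleton (x := (0 : ℝ))).ae_eq_zero_of_integral_contDiff_smul_eq_zero
    (hl.locallyIntegrableOn {0}ᶜ) (fun φ hφ hc hs => by
      have e := (h φ hφ hc hs).symm.trans (h₁ φ hφ hc hs)
      simp only [smul_sub]
      rw [integral_sub (integrable_test_smul g hφ.continuous hc)
        (integrable_test_smul g₁ hφ.continuous hc), neg_injective e, sub_self])
  refine Lp.ext ?_
  have h0 : ∀ᵐ x : ℝ, x ∈ ({0}ᶜ : Set ℝ) := by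
    rw [ae_iff]; simp
  filter_upwards [key, h0] with x hx hx0
  exact sub_eq_zero.1 (hx hx0)

theorem tendsto_add_class {l : Filter ℝ} {f g : L2} {a b : ℂ}
    (hf : Tendsto f (l ⊓ ae volume) (𝓝 a)) (hg : Tendsto g (l ⊓ ae volume) (𝓝 b)) :
    Tendsto (f + g : L2) (l ⊓ ae volume) (𝓝 (a + b)) :=
  (hf.add hg).congr' (((Lp.coeFn_add f g).filter_mono inf_le_right).mono fun _ hx => hx.symm)

theorem tendsto_smul_class {l : Filter ℝ} {f : L2} {a : ℂ} (c : ℂ)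
    (hf : Tendsto f (l ⊓ ae volume) (𝓝 a)) :
    Tendsto (c • f : L2) (l ⊓ ae volume) (𝓝 (c • a)) :=
  (hf.const_smul c).congr' (((Lp.coeFn_smul c f).filter_mono inf_le_right).mono fun _ hx => hx.symm)

theorem tendsto_zero_class (l : Filter ℝ) : Tendsto (0 : L2) (l ⊓ ae volume) (𝓝 0) :=
  tendsto_const_nhds.congr'
    (((Lp.coeFn_zero ℂ 2 (volume : Measure ℝ)).filter_mono inf_le_right).mono fun _ hx => hx.symm)

/-! ### The Hamiltonian of the `δ'` interaction -/

/-- The domain of `H_γ`: the functions `u ∈ H²(ℝ ∖ {0})` with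
`u'(0+) = u'(0-)` and `u(0+) - u(0-) = -γ u'(0+)`. -/
def deltaPrimeDomain (γ : ℝ) : Submodule ℂ L2 where
  carrier := {u | ∃ u' u'' : L2, IsH2With u u' u'' ∧ DeltaPrimeCondition γ u u'}
  zero_mem' := ⟨0, 0, ⟨isWeakDeriv_zero, isWeakDeriv_zero⟩, 0, 0, 0, tendsto_zero_class _,
    tendsto_zero_class _, tendsto_zero_class _, tendsto_zero_class _, by simp⟩
  add_mem' := by
    rintro u v ⟨u', u'', ⟨h1, h2⟩, a, b, d, ha, hb, hd, hd', e⟩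
      ⟨v', v'', ⟨k1, k2⟩, a₁, b₁, d₁, ka, kb, kd, kd', e₁⟩
    exact ⟨u' + v', u'' + v'', ⟨h1.add k1, h2.add k2⟩, a + a₁, b + b₁, d + d₁,
      tendsto_add_class ha ka, tendsto_add_class hb kb, tendsto_add_class hd kd,
      tendsto_add_class hd' kd', by linear_combination e + e₁⟩
  smul_mem' := by
    rintro c u ⟨u', u'', ⟨h1, h2⟩, a, b, d, ha, hb, hd, hd', e⟩
    exact ⟨c • u', c • u'', ⟨h1.const_smul c, h2.const_smul c⟩, c • a, c • b, c • d,
      tendsto_smul_class c ha, tendsto_smul_class c hb, tendsto_smul_class c hd,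
      tendsto_smul_class c hd', by simp only [smul_eq_mul]; linear_combination c * e⟩

theorem exists_second_deriv {γ : ℝ} (u : deltaPrimeDomain γ) :
    ∃ u'' : L2, ∃ u' : L2, IsH2With u u' u'' := by
  obtain ⟨_, u', u'', h, _⟩ := u
  exact ⟨u'', u', h⟩

/-- The second (weak) derivative, away from the origin, of an element of the domain of `H_γ`. -/
def secondDeriv {γ : ℝ} (u : deltaPrimeDomain γ) : L2 :=
  (exists_second_deriv u).choose

theorem secondDeriv_eq {γ : ℝ} {u : deltaPrimeDomain γ} {u' u'' : L2}
    (h : IsH2With u u' u'') : secondDeriv u = u'' := by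
  obtain ⟨v', hv⟩ := (exists_second_deriv u).choose_spec
  obtain rfl := hv.first.unique h.first
  exact hv.second.unique h.second

/-- The Hamiltonian `H_γ` of the `δ'` interaction, an unbounded operator in `L²(ℝ; ℂ)`:
`H_γ u = -u''` away from the origin. -/
def deltaPrimeHamiltonian (γ : ℝ) : L2 →ₗ.[ℂ] L2 where
  domain := deltaPrimeDomain γ
  toFun :=
    { toFun := fun u => -secondDeriv u
      map_add' := by
        intro u v
        obtain ⟨u', hu⟩ := (exists_second_deriv u).choose_spec
        obtain ⟨v', hv⟩ := (exists_second_deriv v).choose_spec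
        have h : IsH2With ((u + v : deltaPrimeDomain γ) : L2) (u' + v')
            (secondDeriv u + secondDeriv v) :=
          ⟨hu.first.add hv.first, hu.second.add hv.second⟩
        rw [secondDeriv_eq h, neg_add]
      map_smul' := by
        intro c u
        obtain ⟨u', hu⟩ := (exists_second_deriv u).choose_spec
        have h : IsH2With ((c • u : deltaPrimeDomain γ) : L2) (c • u') (c • secondDeriv u) :=
          ⟨hu.first.const_smul c, hu.second.const_smul c⟩
        rw [secondDeriv_eq h, smul_neg, RingHom.id_apply] }

/-! ### The linearized operator `L₁` -/

/-- The potential `(2 μ + 1) λ |ψ|^{2 μ}`. -/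
def linearizedPotential (μ lam : ℝ) (ψ : ℝ → ℂ) (x : ℝ) : ℂ :=
  (((2 * μ + 1) * lam * ‖ψ x‖ ^ (2 * μ) : ℝ) : ℂ)

/-- The operator `L₁ u = H_γ u + ω u - (2 μ + 1) λ |ψ|^{2 μ} u` on the domain of `H_γ`, for a
function `ψ` such that the potential is essentially bounded. -/
def linearizedL1 (γ ω μ lam : ℝ) (ψ : ℝ → ℂ)
    (hψ : MemLp (linearizedPotential μ lam ψ) ∞ volume) : L2 →ₗ.[ℂ] L2 where
  domain := (deltaPrimeHamiltonian γ).domain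
  toFun :=
    { toFun := fun u => deltaPrimeHamiltonian γ u + (ω : ℂ) • (u : L2)
        - (hψ.toLp (linearizedPotential μ lam ψ) • (u : L2) : L2)
      map_add' := by
        intro u v
        rw [LinearPMap.map_add, Submodule.coe_add, smul_add, Lp.add_smul]
        abel
      map_smul' := by
        intro c u
        rw [LinearPMap.map_smul, Submodule.coe_smul, RingHom.id_apply, smul_sub, smul_add,
          smul_comm c (ω : ℂ), Lp.smul_comm] }

/-- The eigenspace of an unbounded operator: all `u` in the domain with `L u = ν u`. For `ν = 0`
this is the kernel of `L`. -/
def eigenspaceOf (L : L2 →ₗ.[ℂ] L2) (ν : ℂ) : Submodule ℂ L.domain :=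
  LinearMap.ker (L.toFun - ν • L.domain.subtype)

/-! ### The asymmetric stationary states -/

/-- The frequency of bifurcation `ω* = (4 / γ²) (μ + 1) / μ`. -/
def omegaStar (γ μ : ℝ) : ℝ := 4 / γ ^ 2 * ((μ + 1) / μ)

/-- The soliton
`λ^{-1/(2μ)} (μ+1)^{1/(2μ)} ω^{1/(2μ)} sech^{1/μ} (μ √ω (x - x₀))` centred at `x₀`. -/
def soliton (ω μ lam x₀ x : ℝ) : ℝ :=
  lam ^ (-(1 / (2 * μ))) * (μ + 1) ^ (1 / (2 * μ)) * ω ^ (1 / (2 * μ)) *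
    (1 / Real.cosh (μ * √ω * (x - x₀))) ^ (1 / μ)

/-- The function equal to `-e^{iθ}` times the soliton centred at `x₁` on the negative half-line and
to `e^{iθ}` times the soliton centred at `x₂` on the positive half-line. -/
def solitonPair (ω μ lam x₁ x₂ θ x : ℝ) : ℂ :=
  if x < 0 then -Complex.exp (Complex.I * θ) * (soliton ω μ lam x₁ x : ℂ)
  else Complex.exp (Complex.I * θ) * (soliton ω μ lam x₂ x : ℂ)

/-- `(t₁, t₂)` with `0 < t₁ < t₂` solves the system
`t₁^{2μ} - t₁^{2μ+2} = t₂^{2μ} - t₂^{2μ+2}`, `t₁⁻¹ + t₂⁻¹ = γ √ω`. -/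
def IsAsymmetricSolution (γ ω μ t₁ t₂ : ℝ) : Prop :=
  0 < t₁ ∧ t₁ < t₂ ∧
    t₁ ^ (2 * μ) - t₁ ^ (2 * μ + 2) = t₂ ^ (2 * μ) - t₂ ^ (2 * μ + 2) ∧
    t₁⁻¹ + t₂⁻¹ = γ * √ω

/-- The number `y` with `tanh (μ √ω y) = t`, for `0 < t < 1`. -/
def centre (ω μ t : ℝ) : ℝ := 1 / (2 * μ * √ω) * Real.log |(1 + t) / (1 - t)|

/-- The state `ψ^{y₁, -y₂, θ}_ω` attached to the pair `(t₁, t₂)`. -/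
def asymmetricState (ω μ lam t₁ t₂ θ : ℝ) : ℝ → ℂ :=
  solitonPair ω μ lam (centre ω μ t₁) (-centre ω μ t₂) θ

/-! ### Boundedness of the potential -/

theorem norm_solitonPair (ω μ lam x₁ x₂ θ x : ℝ) :
    ‖solitonPair ω μ lam x₁ x₂ θ x‖ = |soliton ω μ lam (if x < 0 then x₁ else x₂) x| := by
  have h : ‖Complex.exp (Complex.I * θ)‖ = 1 := by
    rw [mul_comm]; exact Complex.norm_exp_ofReal_mul_I θ
  unfold solitonPair
  split_ifs <;> simp [h]

theorem abs_soliton_le {μ : ℝ} (hμ : 0 < μ) (ω lam x₀ x : ℝ) :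
    |soliton ω μ lam x₀ x| ≤
      |lam ^ (-(1 / (2 * μ))) * (μ + 1) ^ (1 / (2 * μ)) * ω ^ (1 / (2 * μ))| := by
  have h1 : 1 ≤ Real.cosh (μ * √ω * (x - x₀)) := Real.one_le_cosh _
  have h2 : |(1 / Real.cosh (μ * √ω * (x - x₀))) ^ (1 / μ)| ≤ 1 := by
    rw [abs_of_nonneg (by positivity)]
    exact Real.rpow_le_one (by positivity) ((div_le_one (by positivity)).2 h1) (by positivity)
  unfold soliton
  rw [abs_mul]
  exact mul_le_of_le_one_right (abs_nonneg _) h2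

theorem measurable_solitonPair (ω μ lam x₁ x₂ θ : ℝ) :
    Measurable (solitonPair ω μ lam x₁ x₂ θ) := by
  have h : ∀ x₀, Measurable (soliton ω μ lam x₀) := fun x₀ => by
    unfold soliton
    have : Measurable fun x : ℝ => Real.cosh (μ * √ω * (x - x₀)) :=
      (Real.continuous_cosh.comp (by fun_prop)).measurable
    fun_prop
  unfold solitonPair
  refine Measurable.ite measurableSet_Iio ?_ ?_
  · exact measurable_const.mul (Complex.measurable_ofReal.comp (h x₁))
  · exact measurable_const.mul (Complex.measurable_ofReal.comp (h x₂))

theorem memLp_linearizedPotential {μ : ℝ} (hμ : 0 < μ) (ω lam t₁ t₂ θ : ℝ) :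
    MemLp (linearizedPotential μ lam (asymmetricState ω μ lam t₁ t₂ θ)) ∞ volume := by
  set C := |lam ^ (-(1 / (2 * μ))) * (μ + 1) ^ (1 / (2 * μ)) * ω ^ (1 / (2 * μ))|
  refine memLp_top_of_bound (C := |(2 * μ + 1) * lam| * C ^ (2 * μ)) ?_ ?_
  · have h := (measurable_solitonPair ω μ lam (centre ω μ t₁) (-centre ω μ t₂) θ).norm
    refine (Complex.measurable_ofReal.comp ?_).aestronglyMeasurable
    exact (h.pow_const (2 * μ)).const_mul _
  · refine ae_of_all _ fun x => ?_
    have hb : ‖asymmetricState ω μ lam t₁ t₂ θ x‖ ≤ C := by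
      unfold asymmetricState
      rw [norm_solitonPair]
      exact abs_soliton_le hμ ω lam _ x
    rw [linearizedPotential, Complex.norm_real, norm_mul, Real.norm_eq_abs, Real.norm_eq_abs,
      abs_of_nonneg (Real.rpow_nonneg (norm_nonneg _) _)]
    gcongr

/-- The potential of `L₁` at `ψ^{y₁, -y₂, θ}_ω` in closed form: it is
`ω (μ + 1) (2 μ + 1) / cosh² (μ √ω (x - y₁))` for `x < 0` and
`ω (μ + 1) (2 μ + 1) / cosh² (μ √ω (x + y₂))` for `x > 0`. -/
theorem linearizedPotential_asymmetricState {ω μ lam : ℝ} (hω : 0 < ω) (hμ : 0 < μ)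
    (hlam : 0 < lam) (t₁ t₂ θ x : ℝ) :
    linearizedPotential μ lam (asymmetricState ω μ lam t₁ t₂ θ) x =
      ((ω * (μ + 1) * (2 * μ + 1) / Real.cosh (μ * √ω *
        (x + if x < 0 then -centre ω μ t₁ else centre ω μ t₂)) ^ 2 : ℝ) : ℂ) := by
  have key : ∀ x₀ : ℝ, |soliton ω μ lam x₀ x| ^ (2 * μ) =
      lam⁻¹ * (μ + 1) * ω / Real.cosh (μ * √ω * (x - x₀)) ^ 2 := fun x₀ => by
    have hc : 0 < Real.cosh (μ * √ω * (x - x₀)) := Real.cosh_pos _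
    unfold soliton
    rw [abs_of_nonneg (by positivity), Real.mul_rpow (by positivity) (by positivity),
      Real.mul_rpow (by positivity) (by positivity), Real.mul_rpow (by positivity) (by positivity),
      ← Real.rpow_mul hlam.le, ← Real.rpow_mul (by positivity), ← Real.rpow_mul hω.le,
      ← Real.rpow_mul (by positivity)]
    have e1 : -(1 / (2 * μ)) * (2 * μ) = -1 := by field_simp
    have e2 : 1 / (2 * μ) * (2 * μ) = 1 := by field_simp
    have e3 : 1 / μ * (2 * μ) = (2 : ℕ) := by field_simp; norm_num
    rw [e1, e2, e3, Real.rpow_neg_one, Real.rpow_one, Real.rpow_one, Real.rpow_natCast]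
    field_simp
  unfold linearizedPotential asymmetricState
  rw [norm_solitonPair, key]
  congr 1
  have e : x - (if x < 0 then centre ω μ t₁ else -centre ω μ t₂) =
      x + if x < 0 then -centre ω μ t₁ else centre ω μ t₂ := by
    split_ifs <;> ring
  rw [e]
  field_simp

end

noncomputable section

/-! ### Hyperbolic inequalities -/

/-! The eigenvalue equation is reduced to one scalar equation in a spectral parameter `m`, whose
roots are counted by Sturm comparison.

In the variable `z = μ√ω|x| + z_j`, where `tanh z_j = t_j`, and with `ν = ω - (μ√ω)² m²`, the
equation `L₁ u = ν u` becomes the Pöschl–Teller equation `f'' = (m² - Λ / cosh²) f` on each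
half-line, with `Λ = (1 + 1/μ)(2 + 1/μ)`. Energy zero is `m₀ = 1/μ`, and negative energies are `m >
m₀`. The square integrable solutions on a half-line are the multiples of the Jost solution,
constructed from a hypergeometric series (`isJost_jost`, `eq_const_mul_of_weak_solution`). An
eigenfunction is therefore a pair of coefficients subject to two matching conditions, and it exists
exactly when `matchDet` vanishes. In terms of the slopes `p_j = -f'(z_j) / f(z_j)` and `κ = γμ√ω`,
this reads `κ p₁ p₂ = p₁ + p₂`, that is `1/p₁ + 1/p₂ = κ`.

Sturm comparison (`IsJost.comparison`) makes each `p_j` strictly increasing in `m`. At `m₀` the Jost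
solution is explicit, being proportional to the derivative of the soliton, so the initial slopes
`g_j` are rational functions of `t_j`. For the asymmetric pair, `g₁ < 0 < g₂` and `1/g₁ + 1/g₂ < κ`.
Hence the determinant is negative at `m₀` (trivial kernel), and it is positive for large `m`, so it
has a root beyond `m₀`. While `p₁ < 0`, the sum `1/p₁ + 1/p₂` stays below `1/g₁ + 1/g₂ < κ`; once
`p₁ > 0`, it is strictly decreasing. The root is therefore unique (`existsUnique_matchDet_eq_zero`).
Simplicity follows because `f'(z₂) ≠ 0` lets one coefficient determine the other.

The algebraic system is solved with the parameter `s = log (t₂ / t₁)`: its first equation gives `t₁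
t₂` as a function of `s`, and the second becomes `curveFun μ s = γ²ω / 4`. This function increases
strictly from `(μ + 1)/μ` to infinity, which is where the threshold `ω*` comes from. One hyperbolic
inequality, `mul_cosh_mul_sinh_lt`, gives both this monotonicity and the bound `1/g₁ + 1/g₂ < κ`. -/

theorem sinh_lt_mul_cosh {x : ℝ} (hx : 0 < x) : Real.sinh x < x * Real.cosh x := by
  have hd : ∀ t : ℝ, HasDerivAt (fun t => t * Real.cosh t - Real.sinh t) (t * Real.sinh t) t := by
    intro t
    have := ((hasDerivAt_id t).mul (Real.hasDerivAt_cosh t)).sub (Real.hasDerivAt_sinh t)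
    refine this.congr_deriv ?_
    simp
  have hmono : StrictMonoOn (fun t => t * Real.cosh t - Real.sinh t) (Set.Ici 0) := by
    refine strictMonoOn_of_deriv_pos (convex_Ici 0)
      (fun t _ => (hd t).continuousAt.continuousWithinAt) fun t ht => ?_
    rw [interior_Ici, Set.mem_Ioi] at ht
    rw [(hd t).deriv]
    exact mul_pos ht (Real.sinh_pos_iff.2 ht)
  have := hmono (Set.mem_Ici.2 le_rfl) (Set.mem_Ici.2 hx.le) hx
  simpa using this

/-- Up to a positive factor, the difference of the two sides is both the derivative of `curveFun`
and the quantity that fixes the sign of the determinant at energy zero. After product-to-sum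
formulas, the bounds `sinh x ≥ x`, `cosh ≥ 1` and `sinh x < x cosh x` balance exactly: `3/2 + 1/2 =
2`. -/
theorem mul_cosh_mul_sinh_lt {μ s : ℝ} (hμ : 0 < μ) (hs : 0 < s) :
    μ * Real.cosh ((μ + 1 / 2) * s) * Real.sinh ((μ + 1) * s) <
      (μ + 1) * Real.sinh (μ * s) * Real.cosh ((μ + 3 / 2) * s) := by
  have p : ∀ A B : ℝ, 2 * (Real.sinh A * Real.cosh B) = Real.sinh (A + B) + Real.sinh (A - B) := by
    intro A B
    rw [Real.sinh_add, Real.sinh_sub]; ring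
  have h1 := p (μ * s) ((μ + 3 / 2) * s)
  have h2 := p ((μ + 1) * s) ((μ + 1 / 2) * s)
  rw [show μ * s + (μ + 3 / 2) * s = 2 * μ * s + 3 / 2 * s by ring,
    show μ * s - (μ + 3 / 2) * s = -(3 / 2 * s) by ring, Real.sinh_neg, Real.sinh_add] at h1
  rw [show (μ + 1) * s + (μ + 1 / 2) * s = 2 * μ * s + 3 / 2 * s by ring,
    show (μ + 1) * s - (μ + 1 / 2) * s = 1 / 2 * s by ring, Real.sinh_add] at h2
  have hc : 0 < Real.cosh (3 / 2 * s) := Real.cosh_pos _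
  have hsh : 0 < Real.sinh (3 / 2 * s) := Real.sinh_pos_iff.2 (by positivity)
  have e1 : 2 * μ * s * Real.cosh (3 / 2 * s) ≤ Real.sinh (2 * μ * s) * Real.cosh (3 / 2 * s) :=
    mul_le_mul_of_nonneg_right (Real.self_le_sinh_iff.2 (by positivity)) hc.le
  have e2 : Real.sinh (3 / 2 * s) ≤ Real.cosh (2 * μ * s) * Real.sinh (3 / 2 * s) :=
    le_mul_of_one_le_left hsh.le (Real.one_le_cosh _)
  have e3 : μ * Real.sinh (3 / 2 * s) < μ * (3 / 2 * s * Real.cosh (3 / 2 * s)) :=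
    mul_lt_mul_of_pos_left (sinh_lt_mul_cosh (by positivity)) hμ
  have e4 : μ * Real.sinh (1 / 2 * s) < μ * (1 / 2 * s * Real.cosh (1 / 2 * s)) :=
    mul_lt_mul_of_pos_left (sinh_lt_mul_cosh (by positivity)) hμ
  have e5 : Real.cosh (1 / 2 * s) ≤ Real.cosh (3 / 2 * s) := by
    rw [Real.cosh_le_cosh, abs_of_pos (by positivity), abs_of_pos (by positivity)]
    linarith
  have e6 : μ * (1 / 2 * s * Real.cosh (1 / 2 * s)) ≤ μ * (1 / 2 * s * Real.cosh (3 / 2 * s)) := by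
    gcongr
  have e7 : 2 * ((μ + 1) * Real.sinh (μ * s) * Real.cosh ((μ + 3 / 2) * s) -
      μ * Real.cosh ((μ + 1 / 2) * s) * Real.sinh ((μ + 1) * s)) =
      Real.sinh (2 * μ * s) * Real.cosh (3 / 2 * s)
        + Real.cosh (2 * μ * s) * Real.sinh (3 / 2 * s)
        - (μ + 1) * Real.sinh (3 / 2 * s) - μ * Real.sinh (1 / 2 * s) := by
    linear_combination (μ + 1) * h1 - μ * h2
  linarith

/-- On the curve this is `(μ + 1) t₁² < μ`. Expanding `sinh (μ s + s)` reduces it to `sinh (μ s)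
e^{-μ s} < μ sinh s e^s`, and `μ s` lies strictly between the two sides. -/
theorem mul_sinh_mul_exp_neg_lt {μ s : ℝ} (hμ : 0 < μ) (hs : 0 < s) :
    (μ + 1) * Real.sinh (μ * s) * Real.exp (-s) < μ * Real.sinh ((μ + 1) * s) := by
  have a1 : Real.sinh (μ * s) * Real.exp (-(μ * s)) < μ * s := by
    have : 1 - 2 * (μ * s) < Real.exp (-(2 * (μ * s))) := by
      have := Real.add_one_lt_exp (x := -(2 * (μ * s))) (by nlinarith [mul_pos hμ hs])
      linarith
    rw [Real.sinh_eq, sub_div, sub_mul, div_mul_eq_mul_div, div_mul_eq_mul_div, ← Real.exp_add,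
      ← Real.exp_add, add_neg_cancel, Real.exp_zero,
      show -(μ * s) + -(μ * s) = -(2 * (μ * s)) by ring]
    linarith
  have a2 : s < Real.sinh s * Real.exp s :=
    ((Real.self_lt_sinh_iff).2 hs).trans
      (lt_mul_of_one_lt_right (Real.sinh_pos_iff.2 hs) (Real.one_lt_exp_iff.2 hs))
  have e : Real.exp (μ * s) * Real.exp (-(μ * s)) = 1 := by rw [← Real.exp_add]; simp
  have e' : Real.exp s * Real.exp (-s) = 1 := by rw [← Real.exp_add]; simp
  have a3 : Real.sinh (μ * s) * Real.exp (-s) < μ * Real.sinh s * Real.exp (μ * s) := by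
    have h : Real.sinh (μ * s) * Real.exp (-(μ * s)) < μ * (Real.sinh s * Real.exp s) :=
      a1.trans (mul_lt_mul_of_pos_left a2 hμ)
    have := mul_lt_mul_of_pos_right h
      (mul_pos (Real.exp_pos (μ * s)) (Real.exp_pos (-s)))
    calc _ = Real.sinh (μ * s) * Real.exp (-(μ * s)) * (Real.exp (μ * s) * Real.exp (-s)) := by
          linear_combination (-Real.sinh (μ * s) * Real.exp (-s)) * e
      _ < _ := this
      _ = _ := by linear_combination (μ * Real.sinh s * Real.exp (μ * s)) * e'
  rw [show (μ + 1) * s = μ * s + s by ring, Real.sinh_add]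
  rw [← Real.cosh_add_sinh (μ * s), ← Real.cosh_sub_sinh s] at a3
  rw [← Real.cosh_sub_sinh s]
  linarith

/-- The companion bound `μ < (μ + 1) t₂²`; here `μ s` separates `μ sinh s e^{-s}` from `sinh (μ s)
e^{μ s}`. -/
theorem mul_sinh_lt_mul_sinh_mul_exp {μ s : ℝ} (hμ : 0 < μ) (hs : 0 < s) :
    μ * Real.sinh ((μ + 1) * s) < (μ + 1) * Real.sinh (μ * s) * Real.exp s := by
  have a1 : μ * s < Real.sinh (μ * s) * Real.exp (μ * s) :=
    ((Real.self_lt_sinh_iff).2 (by positivity)).trans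
      (lt_mul_of_one_lt_right (Real.sinh_pos_iff.2 (by positivity))
        (Real.one_lt_exp_iff.2 (by positivity)))
  have a2 : Real.sinh s * Real.exp (-s) < s := by
    have : 1 - 2 * s < Real.exp (-(2 * s)) := by
      have := Real.add_one_lt_exp (x := -(2 * s)) (by linarith)
      linarith
    rw [Real.sinh_eq, sub_div, sub_mul, div_mul_eq_mul_div, div_mul_eq_mul_div, ← Real.exp_add,
      ← Real.exp_add, add_neg_cancel, Real.exp_zero, show -s + -s = -(2 * s) by ring]
    linarith
  have e : Real.exp (μ * s) * Real.exp (-(μ * s)) = 1 := by rw [← Real.exp_add]; simp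
  have e' : Real.exp s * Real.exp (-s) = 1 := by rw [← Real.exp_add]; simp
  have a3 : μ * Real.sinh s * Real.exp (-(μ * s)) < Real.sinh (μ * s) * Real.exp s := by
    have h : μ * (Real.sinh s * Real.exp (-s)) < Real.sinh (μ * s) * Real.exp (μ * s) :=
      (mul_lt_mul_of_pos_left a2 hμ).trans a1
    have := mul_lt_mul_of_pos_right h
      (mul_pos (Real.exp_pos (-(μ * s))) (Real.exp_pos s))
    calc _ = μ * (Real.sinh s * Real.exp (-s)) * (Real.exp (-(μ * s)) * Real.exp s) := by
          linear_combination (-μ * Real.sinh s * Real.exp (-(μ * s))) * e'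
      _ < _ := this
      _ = _ := by linear_combination (Real.sinh (μ * s) * Real.exp s) * e
  rw [show (μ + 1) * s = μ * s + s by ring, Real.sinh_add]
  rw [← Real.cosh_sub_sinh (μ * s), ← Real.cosh_add_sinh s] at a3
  rw [← Real.cosh_add_sinh s]
  linarith

/-! ### The system for `(t₁, t₂)` -/

/-- The value of `(t₁⁻¹ + t₂⁻¹)² / 4` on the curve
`t₁^{2μ} - t₁^{2μ+2} = t₂^{2μ} - t₂^{2μ+2}`, as a function of `s = log (t₂ / t₁)`. -/
def curveFun (μ s : ℝ) : ℝ :=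
  Real.cosh (s / 2) ^ 2 * Real.sinh ((μ + 1) * s) / Real.sinh (μ * s)

/-- The product `t₁ t₂` on the same curve. -/
def curveProd (μ s : ℝ) : ℝ := Real.sinh (μ * s) / Real.sinh ((μ + 1) * s)

theorem curveProd_pos {μ s : ℝ} (hμ : 0 < μ) (hs : 0 < s) : 0 < curveProd μ s :=
  div_pos (Real.sinh_pos_iff.2 (by positivity)) (Real.sinh_pos_iff.2 (by positivity))

theorem hasDerivAt_curveFun {μ s : ℝ} (hμ : 0 < μ) (hs : 0 < s) :
    HasDerivAt (curveFun μ)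
      (Real.cosh (s / 2) * ((μ + 1) * Real.sinh (μ * s) * Real.cosh ((μ + 3 / 2) * s)
        - μ * Real.cosh ((μ + 1 / 2) * s) * Real.sinh ((μ + 1) * s)) /
          Real.sinh (μ * s) ^ 2) s := by
  have hne : Real.sinh (μ * s) ≠ 0 := (Real.sinh_pos_iff.2 (by positivity)).ne'
  have h1 : HasDerivAt (fun s : ℝ => Real.cosh (s / 2)) (Real.sinh (s / 2) * (1 / 2)) s :=
    ((hasDerivAt_id s).div_const 2).cosh
  have h2 : HasDerivAt (fun s : ℝ => Real.sinh ((μ + 1) * s))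
      (Real.cosh ((μ + 1) * s) * ((μ + 1) * 1)) s := ((hasDerivAt_id s).const_mul (μ + 1)).sinh
  have h3 : HasDerivAt (fun s : ℝ => Real.sinh (μ * s)) (Real.cosh (μ * s) * (μ * 1)) s :=
    ((hasDerivAt_id s).const_mul μ).sinh
  refine (((h1.pow 2).mul h2).div h3 hne).congr_deriv ?_
  rw [show (μ + 3 / 2) * s = (μ + 1) * s + s / 2 by ring,
    show (μ + 1 / 2) * s = μ * s + s / 2 by ring, Real.cosh_add, Real.cosh_add]
  congr 1
  simp only [Pi.mul_apply, Pi.pow_apply]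
  ring

theorem strictMonoOn_curveFun {μ : ℝ} (hμ : 0 < μ) : StrictMonoOn (curveFun μ) (Set.Ioi 0) := by
  refine strictMonoOn_of_deriv_pos (convex_Ioi 0)
    (fun t ht => (hasDerivAt_curveFun hμ ht).continuousAt.continuousWithinAt) fun t ht => ?_
  rw [interior_Ioi, Set.mem_Ioi] at ht
  rw [(hasDerivAt_curveFun hμ ht).deriv]
  have := mul_cosh_mul_sinh_lt hμ ht
  have hne : 0 < Real.sinh (μ * t) := Real.sinh_pos_iff.2 (by positivity)
  have hc := Real.cosh_pos (t / 2)
  exact div_pos (mul_pos hc (by linarith)) (by positivity)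

theorem tendsto_curveFun_zero {μ : ℝ} (hμ : 0 < μ) :
    Tendsto (curveFun μ) (𝓝[>] 0) (𝓝 ((μ + 1) / μ)) := by
  have key : ∀ a : ℝ, Tendsto (fun s : ℝ => s⁻¹ * Real.sinh (a * s)) (𝓝[>] 0) (𝓝 a) := by
    intro a
    have h : HasDerivAt (fun s : ℝ => Real.sinh (a * s)) (Real.cosh (a * 0) * (a * 1)) 0 :=
      ((hasDerivAt_id (0 : ℝ)).const_mul a).sinh
    have := h.hasDerivWithinAt (s := Set.Ioi 0)
    rw [hasDerivWithinAt_iff_tendsto_slope' (by simp)] at this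
    simp only [mul_zero, Real.cosh_zero, one_mul, mul_one] at this
    refine this.congr fun s => ?_
    simp [slope_def_field, div_eq_inv_mul]
  have hc : Tendsto (fun s : ℝ => Real.cosh (s / 2) ^ 2) (𝓝[>] 0) (𝓝 1) := by
    have : Continuous fun s : ℝ => Real.cosh (s / 2) ^ 2 := by fun_prop
    simpa using (this.tendsto 0).mono_left nhdsWithin_le_nhds
  have := (hc.mul (key (μ + 1))).div (key μ) hμ.ne'
  rw [one_mul] at this
  refine this.congr' ?_
  filter_upwards [self_mem_nhdsWithin] with s hs
  have hs' : (s : ℝ) ≠ 0 := ne_of_gt hs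
  have hne : Real.sinh (μ * s) ≠ 0 := (Real.sinh_pos_iff.2 (mul_pos hμ hs)).ne'
  unfold curveFun
  simp only [Pi.div_apply]
  field_simp

theorem le_curveFun {μ s : ℝ} (hμ : 0 < μ) (hs : 0 < s) : s / 2 ≤ curveFun μ s := by
  have h0 : 0 < Real.sinh (μ * s) := Real.sinh_pos_iff.2 (by positivity)
  have h1 : Real.sinh (μ * s) ≤ Real.sinh ((μ + 1) * s) := by
    rw [Real.sinh_le_sinh]; nlinarith
  have h2 : s / 2 ≤ Real.cosh (s / 2) :=
    ((Real.self_le_sinh_iff).2 (by positivity)).trans (Real.sinh_lt_cosh _).le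
  have h3 : Real.cosh (s / 2) ≤ Real.cosh (s / 2) ^ 2 := by
    nlinarith [Real.one_le_cosh (s / 2)]
  unfold curveFun
  rw [le_div_iff₀ h0]
  exact mul_le_mul (h2.trans h3) h1 h0.le (by positivity)

theorem existsUnique_curveFun_eq {μ c : ℝ} (hμ : 0 < μ) (hc : (μ + 1) / μ < c) :
    ∃! s, 0 < s ∧ curveFun μ s = c := by
  obtain ⟨a, ha, hac⟩ : ∃ a, 0 < a ∧ curveFun μ a < c := by
    have := ((tendsto_curveFun_zero hμ).eventually (gt_mem_nhds hc)).and self_mem_nhdsWithin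
    obtain ⟨a, h1, h2⟩ := this.exists
    exact ⟨a, h2, h1⟩
  have hcpos : 0 < c := lt_trans (by positivity) hc
  -- The crude bound `s / 2 ≤ curveFun μ s` shows that any `b ≥ 2c` already overshoots `c`.
  set b := max a (2 * c) with hb
  have hb0 : 0 < b := lt_of_lt_of_le ha (le_max_left _ _)
  have hbc : c ≤ curveFun μ b :=
    (by linarith [le_max_right a (2 * c)] : c ≤ b / 2).trans (le_curveFun hμ hb0)
  have hcont : ContinuousOn (curveFun μ) (Set.Icc a b) := fun t ht =>
    (hasDerivAt_curveFun hμ (lt_of_lt_of_le ha ht.1)).continuousAt.continuousWithinAt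
  obtain ⟨s, hs, hsc⟩ := intermediate_value_Icc (le_max_left a (2 * c)) hcont ⟨hac.le, hbc⟩
  have hs0 : 0 < s := lt_of_lt_of_le ha hs.1
  refine ⟨s, ⟨hs0, hsc⟩, fun r ⟨hr, hrc⟩ => ?_⟩
  exact (strictMonoOn_curveFun hμ).injOn hr hs0 (hrc.trans hsc.symm)

theorem rpow_sub_rpow_add_two {μ t : ℝ} (ht : 0 < t) :
    t ^ (2 * μ) - t ^ (2 * μ + 2) = t ^ (2 * μ) * (1 - t ^ 2) := by
  rw [Real.rpow_add ht, Real.rpow_two]; ring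

/-- With `t₂ = t₁ e^s`, dividing the first equation by `t₁^{2μ}` leaves an equation linear in `t₁²`,
whose solution is `t₁ t₂ = sinh (μ s) / sinh ((μ + 1) s)`. The second equation, squared, is then `4
cosh² (s/2) / (t₁ t₂) = γ² ω`; squaring loses nothing since both sides are positive. -/
theorem isAsymmetricSolution_iff {γ ω μ t₁ t₂ : ℝ} (hγ : 0 < γ) (hμ : 0 < μ) (hω : 0 < ω) :
    IsAsymmetricSolution γ ω μ t₁ t₂ ↔ ∃ s, 0 < s ∧ curveFun μ s = γ ^ 2 * ω / 4 ∧
      t₁ = √(curveProd μ s) * Real.exp (-(s / 2)) ∧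
      t₂ = √(curveProd μ s) * Real.exp (s / 2) := by
  have main : ∀ s t : ℝ, 0 < s → 0 < t →
      ((t ^ (2 * μ) * (1 - t ^ 2) =
        (t * Real.exp s) ^ (2 * μ) * (1 - (t * Real.exp s) ^ 2)) ↔
          t ^ 2 * Real.exp s = curveProd μ s) := by
    intro s t hs ht
    have hS : 0 < Real.sinh ((μ + 1) * s) := Real.sinh_pos_iff.2 (by positivity)
    have ht' : 0 < t ^ (2 * μ) := Real.rpow_pos_of_pos ht _
    rw [Real.mul_rpow ht.le (Real.exp_pos s).le, ← Real.exp_mul, mul_assoc, mul_right_inj' ht'.ne',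
      curveProd, eq_div_iff hS.ne']
    have e1 : Real.exp (s * (2 * μ)) = Real.exp (μ * s) * Real.exp (μ * s) := by
      rw [← Real.exp_add]; ring_nf
    have e2 : Real.exp (μ * s) * Real.exp (-(μ * s)) = 1 := by rw [← Real.exp_add]; simp
    have e3 : Real.exp s * Real.exp (-s) = 1 := by rw [← Real.exp_add]; simp
    rw [Real.sinh_eq, Real.sinh_eq, e1, show (μ + 1) * s = μ * s + s by ring, neg_add,
      Real.exp_add, Real.exp_add]
    set X := Real.exp (μ * s)
    set Y := Real.exp (-(μ * s))
    set Z := Real.exp s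
    set V := Real.exp (-s)
    have hX : X ≠ 0 := (Real.exp_pos _).ne'
    have hkey : X * (t ^ 2 * Z * ((X * Z - Y * V) / 2) - (X - Y) / 2) =
        ((1 - t ^ 2) - X * X * (1 - (t * Z) ^ 2)) / 2 := by
      linear_combination (-(t ^ 2 * Z * V) / 2 + 1 / 2) * e2 - t ^ 2 / 2 * e3
    constructor
    · intro h
      have : X * (t ^ 2 * Z * ((X * Z - Y * V) / 2) - (X - Y) / 2) = 0 := by
        rw [hkey]; linarith
      exact sub_eq_zero.1 ((mul_eq_zero.1 this).resolve_left hX)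
    · intro h
      rw [h, sub_self, mul_zero] at hkey
      linarith
  have sum : ∀ s t : ℝ, 0 < s → 0 < t → t ^ 2 * Real.exp s = curveProd μ s →
      (t⁻¹ + (t * Real.exp s)⁻¹ = γ * √ω ↔ curveFun μ s = γ ^ 2 * ω / 4) := by
    intro s t hs ht h
    have hp := curveProd_pos hμ hs
    have e : curveFun μ s = Real.cosh (s / 2) ^ 2 / curveProd μ s := by
      unfold curveFun curveProd
      rw [div_div_eq_mul_div]
    have e2 : (t⁻¹ + (t * Real.exp s)⁻¹) ^ 2 = 4 * curveFun μ s := by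
      rw [e, ← h, Real.cosh_eq]
      have e4 : Real.exp s = Real.exp (s / 2) ^ 2 := by rw [← Real.exp_nat_mul]; congr 1; push_cast; ring
      rw [Real.exp_neg, e4]
      have := Real.exp_pos (s / 2)
      field_simp
      ring
    have hl : 0 < t⁻¹ + (t * Real.exp s)⁻¹ := by positivity
    constructor
    · intro h'
      rw [h', mul_pow, Real.sq_sqrt hω.le] at e2
      linarith
    · intro h'
      refine (pow_left_inj₀ hl.le (by positivity) two_ne_zero).1 ?_
      rw [e2, h', mul_pow, Real.sq_sqrt hω.le]; ring
  constructor
  · rintro ⟨h0, h12, heq, hsum⟩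
    have h2 := h0.trans h12
    set s := Real.log (t₂ / t₁) with hsdef
    have hs : 0 < s := Real.log_pos ((one_lt_div h0).2 h12)
    have ht2 : t₂ = t₁ * Real.exp s := by
      rw [hsdef, Real.exp_log (div_pos h2 h0)]; field_simp
    rw [rpow_sub_rpow_add_two h0, rpow_sub_rpow_add_two h2, ht2, main s t₁ hs h0] at heq
    rw [ht2, sum s t₁ hs h0 heq] at hsum
    have h1 : t₁ = √(curveProd μ s) * Real.exp (-(s / 2)) := by
      rw [← heq, Real.sqrt_mul (by positivity), Real.sqrt_sq h0.le, ← Real.exp_half, mul_assoc,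
        ← Real.exp_add]
      simp
    refine ⟨s, hs, hsum, h1, ?_⟩
    rw [ht2]
    nth_rw 1 [h1]
    rw [mul_assoc, ← Real.exp_add]
    ring_nf
  · rintro ⟨s, hs, hF, h1, h2⟩
    have hp := curveProd_pos hμ hs
    have ht2 : t₂ = t₁ * Real.exp s := by
      rw [h1, h2, mul_assoc, ← Real.exp_add]; ring_nf
    have h0 : 0 < t₁ := by rw [h1]; positivity
    have hsq : t₁ ^ 2 * Real.exp s = curveProd μ s := by
      rw [h1, mul_pow, Real.sq_sqrt hp.le, mul_assoc, ← Real.exp_nat_mul, ← Real.exp_add]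
      push_cast; ring_nf; simp
    have h12 : t₁ < t₂ := by
      rw [ht2]; exact lt_mul_of_one_lt_right h0 (Real.one_lt_exp_iff.2 hs)
    refine ⟨h0, h12, ?_, ?_⟩
    · rw [rpow_sub_rpow_add_two h0, rpow_sub_rpow_add_two (h0.trans h12), ht2, main s t₁ hs h0]
      exact hsq
    · rw [ht2, sum s t₁ hs h0 hsq]; exact hF

theorem existsUnique_isAsymmetricSolution {γ ω μ : ℝ} (hγ : 0 < γ) (hμ : 0 < μ)
    (hω : omegaStar γ μ < ω) : ∃! t : ℝ × ℝ, IsAsymmetricSolution γ ω μ t.1 t.2 := by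
  have hω0 : 0 < ω := lt_trans (by unfold omegaStar; positivity) hω
  have hc : (μ + 1) / μ < γ ^ 2 * ω / 4 := by
    unfold omegaStar at hω
    rw [div_mul_eq_mul_div, div_lt_iff₀ (by positivity)] at hω
    linarith
  obtain ⟨s, ⟨hs, hsc⟩, huniq⟩ := existsUnique_curveFun_eq hμ hc
  refine ⟨(√(curveProd μ s) * Real.exp (-(s / 2)), √(curveProd μ s) * Real.exp (s / 2)),
    (isAsymmetricSolution_iff hγ hμ hω0).2 ⟨s, hs, hsc, rfl, rfl⟩, ?_⟩
  rintro ⟨t₁, t₂⟩ h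
  obtain ⟨r, hr, hrc, h1, h2⟩ := (isAsymmetricSolution_iff hγ hμ hω0).1 h
  obtain rfl := huniq r ⟨hr, hrc⟩
  exact Prod.ext h1 h2

/-- In the parameter `s`, each of `t_j²` and `1 - t_j²` is a product of exponentials and hyperbolic
sines over `sinh ((μ + 1) s)`, so every claim becomes one of the hyperbolic inequalities. The last
three bounds encode the signs of the slopes at energy zero and of the determinant there. -/
theorem IsAsymmetricSolution.bounds {γ ω μ t₁ t₂ : ℝ} (hγ : 0 < γ) (hμ : 0 < μ) (hω : 0 < ω)
    (h : IsAsymmetricSolution γ ω μ t₁ t₂) :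
    0 < t₁ ∧ t₁ < 1 ∧ 0 < t₂ ∧ t₂ < 1 ∧ (μ + 1) * t₁ ^ 2 < μ ∧ μ < (μ + 1) * t₂ ^ 2 ∧
      t₁ / ((μ + 1) * t₁ ^ 2 - μ) + t₂ / ((μ + 1) * t₂ ^ 2 - μ) < γ * √ω := by
  obtain ⟨h0, h12, -, hsum⟩ := id h
  obtain ⟨s, hs, -, h1, h2⟩ := (isAsymmetricSolution_iff hγ hμ hω).1 h
  have hS : 0 < Real.sinh ((μ + 1) * s) := Real.sinh_pos_iff.2 (by positivity)
  have hp := curveProd_pos hμ hs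
  have hss : 0 < Real.sinh s := Real.sinh_pos_iff.2 hs
  have sq1 : t₁ ^ 2 = Real.sinh (μ * s) * Real.exp (-s) / Real.sinh ((μ + 1) * s) := by
    rw [h1, mul_pow, Real.sq_sqrt hp.le, ← Real.exp_nat_mul, curveProd, div_mul_eq_mul_div]
    push_cast; ring_nf
  have sq2 : t₂ ^ 2 = Real.sinh (μ * s) * Real.exp s / Real.sinh ((μ + 1) * s) := by
    rw [h2, mul_pow, Real.sq_sqrt hp.le, ← Real.exp_nat_mul, curveProd, div_mul_eq_mul_div]
    push_cast; ring_nf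
  have d1 : 1 - t₁ ^ 2 = Real.sinh s * Real.exp (μ * s) / Real.sinh ((μ + 1) * s) := by
    rw [sq1, eq_div_iff hS.ne', sub_mul, div_mul_cancel₀ _ hS.ne',
      show (μ + 1) * s = μ * s + s by ring, Real.sinh_add, ← Real.cosh_sub_sinh s,
      ← Real.cosh_add_sinh (μ * s)]
    ring
  have d2 : 1 - t₂ ^ 2 = Real.sinh s * Real.exp (-(μ * s)) / Real.sinh ((μ + 1) * s) := by
    rw [sq2, eq_div_iff hS.ne', sub_mul, div_mul_cancel₀ _ hS.ne',
      show (μ + 1) * s = μ * s + s by ring, Real.sinh_add, ← Real.cosh_add_sinh s,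
      ← Real.cosh_sub_sinh (μ * s)]
    ring
  have ht2 : 0 < t₂ := h0.trans h12
  have lt2 : t₂ < 1 := by
    have : 0 < 1 - t₂ ^ 2 := by rw [d2]; positivity
    nlinarith
  have a1 : (μ + 1) * t₁ ^ 2 < μ := by
    rw [sq1, mul_div_assoc', div_lt_iff₀ hS, ← mul_assoc]
    exact mul_sinh_mul_exp_neg_lt hμ hs
  have a2 : μ < (μ + 1) * t₂ ^ 2 := by
    rw [sq2, mul_div_assoc', lt_div_iff₀ hS, ← mul_assoc]
    exact mul_sinh_lt_mul_sinh_mul_exp hμ hs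
  refine ⟨h0, h12.trans lt2, ht2, lt2, a1, a2, ?_⟩
  rw [← hsum]
  have b1 : (μ + 1) * t₁ ^ 2 - μ < 0 := by linarith
  have b2 : 0 < (μ + 1) * t₂ ^ 2 - μ := by linarith
  -- This is the numerator left after subtracting `t₁⁻¹ + t₂⁻¹` from the sum to be bounded; it is a
  -- positive multiple of the gap in `mul_cosh_mul_sinh_lt`. The denominator is negative because its
  -- last two factors have opposite signs.
  have hmain : 0 < (1 - t₁ ^ 2) * t₂ * ((μ + 1) * t₂ ^ 2 - μ) +
      (1 - t₂ ^ 2) * t₁ * ((μ + 1) * t₁ ^ 2 - μ) := by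
    have hk := mul_cosh_mul_sinh_lt hμ hs
    have e : (1 - t₁ ^ 2) * t₂ * ((μ + 1) * t₂ ^ 2 - μ) +
        (1 - t₂ ^ 2) * t₁ * ((μ + 1) * t₁ ^ 2 - μ) =
        2 * Real.sinh s * √(curveProd μ s) / Real.sinh ((μ + 1) * s) ^ 2 *
        ((μ + 1) * Real.sinh (μ * s) * Real.cosh ((μ + 3 / 2) * s) -
          μ * Real.cosh ((μ + 1 / 2) * s) * Real.sinh ((μ + 1) * s)) := by
      rw [d1, d2, sq1, sq2, h1, h2, Real.cosh_eq, Real.cosh_eq,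
        show (μ + 3 / 2) * s = μ * s + s + s / 2 by ring,
        show (μ + 1 / 2) * s = μ * s + s / 2 by ring, neg_add, neg_add, neg_add]
      simp only [Real.exp_add]
      field_simp
      ring
    rw [e]
    have := Real.sqrt_pos.2 hp
    have h3 : 0 < (μ + 1) * Real.sinh (μ * s) * Real.cosh ((μ + 3 / 2) * s) -
          μ * Real.cosh ((μ + 1 / 2) * s) * Real.sinh ((μ + 1) * s) := by linarith
    positivity
  have e : t₁ / ((μ + 1) * t₁ ^ 2 - μ) + t₂ / ((μ + 1) * t₂ ^ 2 - μ) - (t₁⁻¹ + t₂⁻¹) =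
      μ * ((1 - t₁ ^ 2) * t₂ * ((μ + 1) * t₂ ^ 2 - μ) +
      (1 - t₂ ^ 2) * t₁ * ((μ + 1) * t₁ ^ 2 - μ)) /
      (t₁ * t₂ * (((μ + 1) * t₁ ^ 2 - μ) * ((μ + 1) * t₂ ^ 2 - μ))) := by
    have c1 := b1.ne
    have c2 := b2.ne'
    generalize ha : (μ + 1) * t₁ ^ 2 - μ = a at c1 ⊢
    generalize hb : (μ + 1) * t₂ ^ 2 - μ = b at c2 ⊢
    have e1 : t₁ / a - t₁⁻¹ = μ * (1 - t₁ ^ 2) / (t₁ * a) := by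
      field_simp
      rw [← ha]; ring
    have e2 : t₂ / b - t₂⁻¹ = μ * (1 - t₂ ^ 2) / (t₂ * b) := by
      field_simp
      rw [← hb]; ring
    rw [add_sub_add_comm, e1, e2]
    field_simp
  have : μ * ((1 - t₁ ^ 2) * t₂ * ((μ + 1) * t₂ ^ 2 - μ) +
      (1 - t₂ ^ 2) * t₁ * ((μ + 1) * t₁ ^ 2 - μ)) /
      (t₁ * t₂ * (((μ + 1) * t₁ ^ 2 - μ) * ((μ + 1) * t₂ ^ 2 - μ))) < 0 :=
    div_neg_of_pos_of_neg (mul_pos hμ hmain)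
      (mul_neg_of_pos_of_neg (mul_pos h0 ht2) (mul_neg_of_neg_of_pos b1 b2))
  linarith

/-! ### Power series with polynomially bounded coefficients -/

/-- The coefficients `a n` grow at most polynomially. -/
def PolyBounded (a : ℕ → ℝ) : Prop := ∃ C : ℝ, ∃ p : ℕ, ∀ n, |a n| ≤ C * ((n : ℝ) + 1) ^ p

theorem summable_succ_pow_mul_pow (p : ℕ) {r : ℝ} (h0 : 0 < r) (h1 : r < 1) :
    Summable fun n : ℕ => ((n : ℝ) + 1) ^ p * r ^ n := by
  have h := (summable_nat_add_iff 1).2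
    (summable_pow_mul_geometric_of_norm_lt_one p (r := r) (by rwa [Real.norm_of_nonneg h0.le]))
  refine (h.mul_right r⁻¹).congr fun n => ?_
  push_cast
  rw [pow_succ]
  field_simp

theorem PolyBounded.summable {a : ℕ → ℝ} (ha : PolyBounded a) {w : ℝ} (hw : |w| < 1) :
    Summable fun n => a n * w ^ n := by
  obtain ⟨C, p, h⟩ := ha
  obtain ⟨r, hr, hr1⟩ := exists_between hw
  have hr0 : 0 < r := (abs_nonneg w).trans_lt hr
  refine Summable.of_norm_bounded ((summable_succ_pow_mul_pow p hr0 hr1).mul_left C) fun n => ?_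
  rw [norm_mul, norm_pow, Real.norm_eq_abs, Real.norm_eq_abs, ← mul_assoc]
  exact mul_le_mul (h n) (pow_le_pow_left₀ (abs_nonneg _) hr.le n) (by positivity)
    ((abs_nonneg _).trans (h n))

theorem PolyBounded.succ_mul {a : ℕ → ℝ} (ha : PolyBounded a) :
    PolyBounded fun n => ((n : ℝ) + 1) * a (n + 1) := by
  obtain ⟨C, p, h⟩ := ha
  have hC : 0 ≤ C := by simpa using (abs_nonneg _).trans (h 0)
  refine ⟨C * 2 ^ p, p + 1, fun n => ?_⟩
  rw [abs_mul, abs_of_nonneg (by positivity : (0 : ℝ) ≤ (n : ℝ) + 1)]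
  have h1 : |a (n + 1)| ≤ C * (2 * ((n : ℝ) + 1)) ^ p := by
    refine (h (n + 1)).trans ?_
    push_cast
    gcongr
    linarith [Nat.cast_nonneg (α := ℝ) n]
  calc ((n : ℝ) + 1) * |a (n + 1)| ≤ ((n : ℝ) + 1) * (C * (2 * ((n : ℝ) + 1)) ^ p) := by gcongr
    _ = _ := by rw [mul_pow]; ring

theorem PolyBounded.nat_mul {a : ℕ → ℝ} (ha : PolyBounded a) :
    PolyBounded fun n => (n : ℝ) * a n := by
  obtain ⟨C, p, h⟩ := ha
  have hC : 0 ≤ C := by simpa using (abs_nonneg _).trans (h 0)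
  refine ⟨C, p + 1, fun n => ?_⟩
  rw [abs_mul, Nat.abs_cast, pow_succ, ← mul_assoc, mul_comm]
  exact mul_le_mul (h n) (by linarith) (by positivity) (by positivity)

/-- An index shift, used to write every term of the hypergeometric equation as a series in the same
power `w ^ n`. -/
theorem mul_tsum_succ {b : ℕ → ℝ} (h0 : b 0 = 0) {w : ℝ} (hb : Summable fun n => b n * w ^ n) :
    w * ∑' n, b (n + 1) * w ^ n = ∑' n, b n * w ^ n := by
  rw [hb.tsum_eq_zero_add, h0, zero_mul, zero_add, ← tsum_mul_left]
  refine tsum_congr fun n => ?_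
  ring

theorem PolyBounded.hasDerivAt_tsum {a : ℕ → ℝ} (ha : PolyBounded a) {w : ℝ} (hw : |w| < 1) :
    HasDerivAt (fun w => ∑' n, a n * w ^ n) (∑' n : ℕ, ((n : ℝ) + 1) * a (n + 1) * w ^ n) w := by
  obtain ⟨r, hr, hr1⟩ := exists_between hw
  have hr0 : 0 < r := (abs_nonneg w).trans_lt hr
  obtain ⟨C, p, h⟩ := ha.nat_mul
  have hC : 0 ≤ C := by simpa using (abs_nonneg _).trans (h 0)
  have hu : Summable fun n : ℕ => C * r⁻¹ * (((n : ℝ) + 1) ^ p * r ^ n) :=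
    (summable_succ_pow_mul_pow p hr0 hr1).mul_left _
  have key := hasDerivAt_tsum_of_isPreconnected (g := fun n w => a n * w ^ n)
    (g' := fun n w => a n * (n * w ^ (n - 1))) hu (Metric.isOpen_ball (x := (0 : ℝ)) (ε := r))
    (convex_ball 0 r).isPreconnected
    (fun n y _ => (hasDerivAt_pow n y).const_mul (a n))
    (fun n y hy => by
      rw [mem_ball_zero_iff, Real.norm_eq_abs] at hy
      have e : a n * (n * y ^ (n - 1)) = (n * a n) * y ^ (n - 1) := by ring
      rw [e, norm_mul, norm_pow, Real.norm_eq_abs, Real.norm_eq_abs]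
      -- For `n = 0` the exponent `n - 1` truncates to `0`, but the factor `n` kills the term.
      rcases Nat.eq_zero_or_pos n with rfl | hn
      · simp; positivity
      · have e2 : r⁻¹ * r ^ n = r ^ (n - 1) := by
          obtain ⟨k, rfl⟩ := Nat.exists_eq_succ_of_ne_zero hn.ne'
          rw [Nat.succ_sub_one, pow_succ]; field_simp
        calc |n * a n| * |y| ^ (n - 1) ≤ C * ((n : ℝ) + 1) ^ p * r ^ (n - 1) :=
              mul_le_mul (h n) (pow_le_pow_left₀ (abs_nonneg _) hy.le _) (by positivity)
                (by positivity)
          _ = _ := by rw [← e2]; ring)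
    (y₀ := 0) (Metric.mem_ball_self hr0) (ha.summable (by simp))
    (y := w) (by rwa [mem_ball_zero_iff, Real.norm_eq_abs])
  refine key.congr_deriv ?_
  have hs : Summable fun n : ℕ => a n * (n * w ^ (n - 1)) := by
    refine (summable_nat_add_iff 1).1 ((ha.succ_mul.summable hw).congr fun n => ?_)
    simp only [Nat.add_sub_cancel]; push_cast; ring
  rw [hs.tsum_eq_zero_add]
  simp only [Nat.cast_zero, zero_mul, mul_zero, zero_add, Nat.add_sub_cancel]
  refine tsum_congr fun n => ?_
  push_cast; ring

/-! ### The hypergeometric series -/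

/-- The Taylor coefficients of the solution `S` with `S 0 = 1` of
`w (1 - w) S'' + (m + 1 - 2 w) S' + Λ S = 0`. -/
def hyperCoeff (Λ m : ℝ) : ℕ → ℝ
  | 0 => 1
  | n + 1 => hyperCoeff Λ m n * ((n * (n + 1) - Λ) / ((n + 1) * (n + 1 + m)))

/-- The ratio of consecutive coefficients is at most `1` in absolute value once `n ≥ Λ`, and at most
`1 + Λ` before that. Uniformity in `m` is the point: it gives continuity in `m` and the limit `m →
∞` by domination. -/
theorem exists_hyperCoeff_bound {Λ : ℝ} (hΛ : 0 ≤ Λ) :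
    ∃ C : ℝ, ∀ m, 0 ≤ m → ∀ n, |hyperCoeff Λ m n| ≤ C := by
  obtain ⟨N, hN⟩ := exists_nat_ge Λ
  have key : ∀ m, 0 ≤ m → ∀ n, |hyperCoeff Λ m n| ≤ (1 + Λ) ^ min n N := by
    intro m hm n
    induction n with
    | zero => simp [hyperCoeff]
    | succ n ih =>
      rw [hyperCoeff, abs_mul, abs_div, abs_of_nonneg (by positivity : 0 ≤ ((n : ℝ) + 1) * (n + 1 + m))]
      have hn : (0 : ℝ) ≤ n := Nat.cast_nonneg n
      rcases lt_or_ge n N with h | h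
      · rw [min_eq_left h.le] at ih
        rw [min_eq_left (Nat.succ_le_of_lt h), pow_succ]
        refine mul_le_mul ih ?_ (by positivity) (by positivity)
        rw [div_le_iff₀ (by positivity), abs_le]
        constructor <;> nlinarith [mul_nonneg hn hm, mul_nonneg hΛ hn, mul_nonneg hΛ hm,
          mul_nonneg (mul_nonneg hΛ hn) hm, mul_nonneg hn hn, mul_nonneg (mul_nonneg hΛ hn) hn]
      · rw [min_eq_right h] at ih
        rw [min_eq_right (h.trans n.le_succ)]
        refine (mul_le_of_le_one_right (abs_nonneg _) ?_).trans ih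
        have hN' : Λ ≤ n := hN.trans (by exact_mod_cast h)
        rw [div_le_one (by positivity), abs_le]
        constructor <;> nlinarith [mul_nonneg hn hm, mul_nonneg hn hn]
  refine ⟨(1 + Λ) ^ N, fun m hm n => (key m hm n).trans ?_⟩
  exact pow_le_pow_right₀ (by linarith) (min_le_right _ _)

theorem polyBounded_hyperCoeff {Λ m : ℝ} (hΛ : 0 ≤ Λ) (hm : 0 ≤ m) :
    PolyBounded (hyperCoeff Λ m) := by
  obtain ⟨C, hC⟩ := exists_hyperCoeff_bound hΛ
  exact ⟨C, 0, fun n => by simpa using hC m hm n⟩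

theorem hyperCoeff_succ {Λ m : ℝ} (hm : 0 ≤ m) (n : ℕ) :
    hyperCoeff Λ m (n + 1) * ((n + 1) * (n + 1 + m)) = hyperCoeff Λ m n * (n * (n + 1) - Λ) := by
  have : ((n : ℝ) + 1) * (n + 1 + m) ≠ 0 := by positivity
  rw [hyperCoeff, mul_assoc, div_mul_cancel₀ _ this]

theorem continuousOn_hyperCoeff (Λ : ℝ) (n : ℕ) :
    ContinuousOn (fun m => hyperCoeff Λ m n) (Set.Ici 0) := by
  induction n with
  | zero => simpa [hyperCoeff] using continuousOn_const
  | succ n ih =>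
    simp only [hyperCoeff]
    refine ih.mul (ContinuousOn.div continuousOn_const (by fun_prop) fun m hm => ?_)
    have : (0 : ℝ) ≤ m := hm
    positivity

theorem tendsto_hyperCoeff_atTop {Λ : ℝ} (hΛ : 0 ≤ Λ) (n : ℕ) :
    Tendsto (fun m => hyperCoeff Λ m (n + 1)) atTop (𝓝 0) := by
  obtain ⟨C, hC⟩ := exists_hyperCoeff_bound hΛ
  simp only [hyperCoeff]
  refine bdd_le_mul_tendsto_zero' C ?_ ?_
  · filter_upwards [eventually_ge_atTop 0] with m hm using hC m hm n
  · refine Tendsto.const_div_atTop ?_ _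
    exact (tendsto_atTop_add_const_left _ _ tendsto_id).const_mul_atTop (by positivity)

/-- The hypergeometric function `₂F₁(-l, l + 1; 1 + m; w)` with `l (l + 1) = Λ`. -/
def hyperSum (Λ m w : ℝ) : ℝ := ∑' n, hyperCoeff Λ m n * w ^ n

/-- The derivative of `hyperSum`. -/
def hyperSum' (Λ m w : ℝ) : ℝ := ∑' n : ℕ, ((n : ℝ) + 1) * hyperCoeff Λ m (n + 1) * w ^ n

/-- The second derivative of `hyperSum`. -/
def hyperSum'' (Λ m w : ℝ) : ℝ :=
  ∑' n : ℕ, ((n : ℝ) + 1) * ((((n + 1 : ℕ) : ℝ) + 1) * hyperCoeff Λ m (n + 1 + 1)) * w ^ n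

theorem hasDerivAt_hyperSum {Λ m w : ℝ} (hΛ : 0 ≤ Λ) (hm : 0 ≤ m) (hw : |w| < 1) :
    HasDerivAt (hyperSum Λ m) (hyperSum' Λ m w) w :=
  (polyBounded_hyperCoeff hΛ hm).hasDerivAt_tsum hw

theorem hasDerivAt_hyperSum' {Λ m w : ℝ} (hΛ : 0 ≤ Λ) (hm : 0 ≤ m) (hw : |w| < 1) :
    HasDerivAt (hyperSum' Λ m) (hyperSum'' Λ m w) w :=
  (polyBounded_hyperCoeff hΛ hm).succ_mul.hasDerivAt_tsum hw

/-- Comparing coefficients of `w ^ n`, the equation is exactly the recurrence `hyperCoeff_succ`. -/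
theorem hyperSum_ode {Λ m w : ℝ} (hΛ : 0 ≤ Λ) (hm : 0 ≤ m) (hw : |w| < 1) :
    w * (1 - w) * hyperSum'' Λ m w + (m + 1 - 2 * w) * hyperSum' Λ m w + Λ * hyperSum Λ m w = 0 := by
  set c := hyperCoeff Λ m with hc
  have hb : PolyBounded c := polyBounded_hyperCoeff hΛ hm
  have s0 : Summable fun n => c n * w ^ n := hb.summable hw
  have s1 : Summable fun n : ℕ => ((n : ℝ) + 1) * c (n + 1) * w ^ n := hb.succ_mul.summable hw
  have s2 : Summable fun n : ℕ => (n : ℝ) * (((n : ℝ) + 1) * c (n + 1)) * w ^ n :=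
    hb.succ_mul.nat_mul.summable hw
  have s3 : Summable fun n : ℕ => (n : ℝ) * c n * w ^ n := hb.nat_mul.summable hw
  have s4 : Summable fun n : ℕ => (n : ℝ) * ((n : ℝ) * c n) * w ^ n :=
    hb.nat_mul.nat_mul.summable hw
  have e1 : w * hyperSum' Λ m w = ∑' n : ℕ, (n : ℝ) * c n * w ^ n := by
    rw [← mul_tsum_succ (b := fun n : ℕ => (n : ℝ) * c n) (by simp) s3, hyperSum']
    push_cast; rfl
  have e2 : w * hyperSum'' Λ m w = ∑' n : ℕ, (n : ℝ) * (((n : ℝ) + 1) * c (n + 1)) * w ^ n := by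
    rw [← mul_tsum_succ (b := fun n : ℕ => (n : ℝ) * (((n : ℝ) + 1) * c (n + 1))) (by simp) s2,
      hyperSum'']
    push_cast; rfl
  have s5 : Summable fun n : ℕ => (n : ℝ) * (((n : ℝ) - 1) * c n) * w ^ n :=
    (s4.sub s3).congr fun n => by ring
  have e3 : w * (w * hyperSum'' Λ m w) = ∑' n : ℕ, (n : ℝ) * (((n : ℝ) - 1) * c n) * w ^ n := by
    rw [e2, ← mul_tsum_succ (b := fun n : ℕ => (n : ℝ) * (((n : ℝ) - 1) * c n)) (by simp) s5]
    congr 1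
    refine tsum_congr fun n => ?_
    push_cast; ring
  have expand : w * (1 - w) * hyperSum'' Λ m w + (m + 1 - 2 * w) * hyperSum' Λ m w
      + Λ * hyperSum Λ m w = w * hyperSum'' Λ m w - w * (w * hyperSum'' Λ m w)
      + (m + 1) * hyperSum' Λ m w - 2 * (w * hyperSum' Λ m w) + Λ * hyperSum Λ m w := by ring
  rw [expand, e3, e2, e1, hyperSum', hyperSum, ← tsum_mul_left, ← tsum_mul_left, ← tsum_mul_left,
    ← s2.tsum_sub s5, ← (s2.sub s5).tsum_add (s1.mul_left _),
    ← ((s2.sub s5).add (s1.mul_left _)).tsum_sub (s3.mul_left _),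
    ← (((s2.sub s5).add (s1.mul_left _)).sub (s3.mul_left _)).tsum_add (s0.mul_left _)]
  refine (tsum_congr fun n => ?_).trans tsum_zero
  have := hyperCoeff_succ (Λ := Λ) hm n
  linear_combination (w ^ n) * this

theorem continuousOn_hyperSum {Λ w : ℝ} (hΛ : 0 ≤ Λ) (hw0 : 0 < w) (hw : w < 1) :
    ContinuousOn (fun m => hyperSum Λ m w) (Set.Ici 0) := by
  obtain ⟨C, hC⟩ := exists_hyperCoeff_bound hΛ
  refine continuousOn_tsum (u := fun n => C * w ^ n)
    (fun n => (continuousOn_hyperCoeff Λ n).mul continuousOn_const)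
    ((summable_geometric_of_lt_one hw0.le hw).mul_left C) fun n m hm => ?_
  rw [norm_mul, Real.norm_eq_abs, Real.norm_of_nonneg (pow_nonneg hw0.le n)]
  exact mul_le_mul_of_nonneg_right (hC m hm n) (pow_nonneg hw0.le n)

theorem continuousOn_hyperSum' {Λ w : ℝ} (hΛ : 0 ≤ Λ) (hw0 : 0 < w) (hw : w < 1) :
    ContinuousOn (fun m => hyperSum' Λ m w) (Set.Ici 0) := by
  obtain ⟨C, hC⟩ := exists_hyperCoeff_bound hΛ
  refine continuousOn_tsum (u := fun n : ℕ => C * (((n : ℝ) + 1) ^ 1 * w ^ n))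
    (fun n => (continuousOn_const.mul (continuousOn_hyperCoeff Λ (n + 1))).mul continuousOn_const)
    ((summable_succ_pow_mul_pow 1 hw0 hw).mul_left C) fun n m hm => ?_
  have hn : (0 : ℝ) ≤ (n : ℝ) + 1 := by positivity
  rw [norm_mul, norm_mul, Real.norm_of_nonneg hn, Real.norm_eq_abs,
    Real.norm_of_nonneg (pow_nonneg hw0.le n), pow_one, ← mul_assoc, mul_comm C]
  have := hC m hm (n + 1)
  have := pow_nonneg hw0.le n
  gcongr

/-- Every coefficient but the constant one tends to `0` as `m → ∞`, under a geometric majorant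
independent of `m`. -/
theorem tendsto_hyperSum_atTop {Λ w : ℝ} (hΛ : 0 ≤ Λ) (hw0 : 0 < w) (hw : w < 1) :
    Tendsto (fun m => hyperSum Λ m w) atTop (𝓝 1) := by
  obtain ⟨C, hC⟩ := exists_hyperCoeff_bound hΛ
  have h := tendsto_tsum_of_dominated_convergence (𝓕 := atTop)
    (f := fun m n => hyperCoeff Λ m n * w ^ n) (g := fun n => if n = 0 then (1 : ℝ) else 0)
    (bound := fun n => C * w ^ n) ((summable_geometric_of_lt_one hw0.le hw).mul_left C)
    (fun n => by
      rcases n with _ | n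
      · simp [hyperCoeff]
      · simpa using (tendsto_hyperCoeff_atTop hΛ n).mul_const (w ^ (n + 1)))
    (by
      filter_upwards [eventually_ge_atTop 0] with m hm n
      rw [norm_mul, Real.norm_eq_abs, Real.norm_of_nonneg (pow_nonneg hw0.le n)]
      exact mul_le_mul_of_nonneg_right (hC m hm n) (pow_nonneg hw0.le n))
  rwa [tsum_ite_eq] at h

theorem tendsto_hyperSum'_atTop {Λ w : ℝ} (hΛ : 0 ≤ Λ) (hw0 : 0 < w) (hw : w < 1) :
    Tendsto (fun m => hyperSum' Λ m w) atTop (𝓝 0) := by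
  obtain ⟨C, hC⟩ := exists_hyperCoeff_bound hΛ
  have h := tendsto_tsum_of_dominated_convergence (𝓕 := atTop)
    (f := fun m (n : ℕ) => ((n : ℝ) + 1) * hyperCoeff Λ m (n + 1) * w ^ n)
    (g := fun _ => (0 : ℝ))
    (bound := fun n : ℕ => C * (((n : ℝ) + 1) ^ 1 * w ^ n))
    ((summable_succ_pow_mul_pow 1 hw0 hw).mul_left C)
    (fun n => by
      simpa using ((tendsto_hyperCoeff_atTop hΛ n).const_mul ((n : ℝ) + 1)).mul_const (w ^ n))
    (by
      filter_upwards [eventually_ge_atTop 0] with m hm n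
      have hn : (0 : ℝ) ≤ (n : ℝ) + 1 := by positivity
      rw [norm_mul, norm_mul, Real.norm_of_nonneg hn, Real.norm_eq_abs,
        Real.norm_of_nonneg (pow_nonneg hw0.le n), pow_one, ← mul_assoc, mul_comm C]
      have := hC m hm (n + 1)
      have := pow_nonneg hw0.le n
      gcongr)
  rwa [tsum_zero] at h

/-! ### Jost solutions of the Pöschl–Teller equation -/

/-- `f`, with derivative `f'`, is the solution of `f'' = (m² - Λ / cosh²) f` that is asymptotic to
`exp (-m z)` at infinity. -/
structure IsJost (Λ m : ℝ) (f f' : ℝ → ℝ) : Prop where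
  hasDerivAt : ∀ z, HasDerivAt f (f' z) z
  hasDerivAt' : ∀ z, HasDerivAt f' ((m ^ 2 - Λ / Real.cosh z ^ 2) * f z) z
  tendsto : Tendsto (fun z => Real.exp (m * z) * f z) atTop (𝓝 1)
  tendsto' : Tendsto (fun z => Real.exp (m * z) * f' z) atTop (𝓝 (-m))

namespace IsJost

variable {Λ m m' z₀ : ℝ} {f f' g g' : ℝ → ℝ}

theorem continuous (hf : IsJost Λ m f f') : Continuous f :=
  continuous_iff_continuousAt.2 fun z => (hf.hasDerivAt z).continuousAt

theorem continuous' (hf : IsJost Λ m f f') : Continuous f' :=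
  continuous_iff_continuousAt.2 fun z => (hf.hasDerivAt' z).continuousAt

theorem tendsto_exp_neg (hm : 0 < m) : Tendsto (fun z => Real.exp (-(m * z))) atTop (𝓝 0) :=
  Real.tendsto_exp_neg_atTop_nhds_zero.comp (tendsto_id.const_mul_atTop hm)

theorem tendsto_zero (hf : IsJost Λ m f f') (hm : 0 < m) : Tendsto f atTop (𝓝 0) := by
  have := (tendsto_exp_neg hm).mul hf.tendsto
  rw [zero_mul] at this
  refine this.congr fun z => ?_
  rw [← mul_assoc, ← Real.exp_add]; simp

theorem tendsto_zero' (hf : IsJost Λ m f f') (hm : 0 < m) : Tendsto f' atTop (𝓝 0) := by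
  have := (tendsto_exp_neg hm).mul hf.tendsto'
  rw [zero_mul] at this
  refine this.congr fun z => ?_
  rw [← mul_assoc, ← Real.exp_add]; simp

theorem eventually_pos (hf : IsJost Λ m f f') : ∀ᶠ z in atTop, 0 < f z := by
  filter_upwards [hf.tendsto.eventually (lt_mem_nhds one_pos)] with z hz
  exact pos_of_mul_pos_right hz (Real.exp_pos _).le

theorem tendsto_logDeriv (hf : IsJost Λ m f f') : Tendsto (fun z => f' z / f z) atTop (𝓝 (-m)) := by
  have := hf.tendsto'.div hf.tendsto one_ne_zero
  rw [div_one] at this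
  refine this.congr fun z => ?_
  exact mul_div_mul_left _ _ (Real.exp_pos _).ne'

/-- Sturm comparison for decaying solutions: a more negative energy gives a positive solution with
a smaller logarithmic derivative. -/
theorem comparison (hf : IsJost Λ m f f') (hg : IsJost Λ m' g g') (hm' : 0 < m') (hmm : m' < m)
    (hpos : ∀ z, z₀ ≤ z → 0 < g z) :
    (∀ z, z₀ ≤ z → 0 < f z) ∧ ∀ z, z₀ ≤ z → f' z / f z < g' z / g z := by
  have hm : 0 < m := hm'.trans hmm
  -- Picone's identity: the derivative of `E` is a square plus `(m² - m'²) f²`, so `E` increases to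
  -- its limit `0` at infinity. Its negativity forbids zeros of `f` and, after division by `f²`,
  -- compares the logarithmic derivatives.
  set E : ℝ → ℝ := fun z => f z * f' z - f z ^ 2 * (g' z / g z) with hE
  have hsq : 0 < m ^ 2 - m' ^ 2 := by nlinarith
  have hd : ∀ z, z₀ ≤ z → HasDerivAt E
      ((f' z - f z * (g' z / g z)) ^ 2 + (m ^ 2 - m' ^ 2) * f z ^ 2) z := by
    intro z hz
    have hgz := (hpos z hz).ne'
    have := ((hf.hasDerivAt z).mul (hf.hasDerivAt' z)).sub (((hf.hasDerivAt z).pow 2).mul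
      ((hg.hasDerivAt' z).div (hg.hasDerivAt z) hgz))
    refine this.congr_deriv ?_
    simp only [Pi.pow_apply, Pi.div_apply]
    field_simp
    ring
  have hmono : MonotoneOn E (Set.Ici z₀) := by
    refine monotoneOn_of_deriv_nonneg (convex_Ici z₀)
      (fun t ht => (hd t ht).continuousAt.continuousWithinAt) (fun t ht => ?_) fun t ht => ?_
    · rw [interior_Ici] at ht
      exact (hd t (le_of_lt ht)).differentiableAt.differentiableWithinAt
    · rw [interior_Ici] at ht
      rw [(hd t (le_of_lt ht)).deriv]
      positivity
  have hlim : Tendsto E atTop (𝓝 0) := by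
    have := ((hf.tendsto_zero hm).mul (hf.tendsto_zero' hm)).sub
      (((hf.tendsto_zero hm).pow 2).mul hg.tendsto_logDeriv)
    simpa using this
  have hle : ∀ z, z₀ ≤ z → E z ≤ 0 := fun z hz =>
    ge_of_tendsto hlim ((eventually_ge_atTop z).mono fun t ht => hmono hz (hz.trans ht) ht)
  have hlt : ∀ z, z₀ ≤ z → E z < 0 := by
    intro z hz
    -- Equality would make `E` constant on `[z, ∞)`, although its derivative is positive wherever `f
    -- > 0`, in particular far out.
    refine lt_of_le_of_ne (hle z hz) fun h0 => ?_
    have hconst : ∀ t, z ≤ t → E t = 0 := fun t ht =>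
      le_antisymm (hle t (hz.trans ht)) (h0 ▸ hmono hz (hz.trans ht) ht)
    obtain ⟨t, htz, htf⟩ := ((eventually_gt_atTop z).and hf.eventually_pos).exists
    have h1 : HasDerivAt E 0 t := (hasDerivAt_const t (0 : ℝ)).congr_of_eventuallyEq
      ((lt_mem_nhds htz).mono fun s hs => hconst s (le_of_lt hs))
    have h2 := (hd t (hz.trans htz.le)).unique h1
    have h3 : 0 < (m ^ 2 - m' ^ 2) * f t ^ 2 := by positivity
    nlinarith [sq_nonneg (f' t - f t * (g' t / g t))]
  have hne : ∀ z, z₀ ≤ z → f z ≠ 0 := by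
    intro z hz h0
    have := hlt z hz
    simp [hE, h0] at this
  have hfpos : ∀ z, z₀ ≤ z → 0 < f z := by
    intro z hz
    by_contra! hneg
    obtain ⟨t, htz, htf⟩ := ((eventually_ge_atTop z).and hf.eventually_pos).exists
    obtain ⟨s, hs, hs0⟩ := intermediate_value_Icc htz hf.continuous.continuousOn ⟨hneg, htf.le⟩
    exact hne s (hz.trans hs.1) hs0
  refine ⟨hfpos, fun z hz => ?_⟩
  have h1 := hlt z hz
  have h2 := hfpos z hz
  have h3 : f z * f' z < f z * (f z * (g' z / g z)) := by
    simp only [hE] at h1; nlinarith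
  rw [div_lt_iff₀ h2, mul_comm]
  exact lt_of_mul_lt_mul_left h3 h2.le

/-- The Wronskian is constant and tends to `0`, so `f / g` is constant where `g > 0`, and the
normalization at infinity makes that constant `1`. Positivity is only required on an open half-line
because the explicit solution vanishes at `0`. -/
theorem eq_of_pos (hf : IsJost Λ m f f') (hg : IsJost Λ m g g') (hm : 0 < m)
    (hpos : ∀ z, z₀ < z → 0 < g z) {z : ℝ} (hz : z₀ < z) : f z = g z ∧ f' z = g' z := by
  have hW : ∀ t, HasDerivAt (fun t => f t * g' t - f' t * g t) 0 t := fun t =>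
    (((hf.hasDerivAt t).mul (hg.hasDerivAt' t)).sub
      ((hf.hasDerivAt' t).mul (hg.hasDerivAt t))).congr_deriv (by ring)
  have hWlim : Tendsto (fun t => f t * g' t - f' t * g t) atTop (𝓝 0) := by
    simpa using ((hf.tendsto_zero hm).mul (hg.tendsto_zero' hm)).sub
      ((hf.tendsto_zero' hm).mul (hg.tendsto_zero hm))
  have hW0 : ∀ t, f t * g' t - f' t * g t = 0 := by
    intro t
    have hc : ∀ s, f s * g' s - f' s * g s = f t * g' t - f' t * g t := fun s =>
      is_const_of_deriv_eq_zero (fun s => (hW s).differentiableAt) (fun s => (hW s).deriv) s t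
    exact tendsto_nhds_unique (tendsto_const_nhds.congr fun s => (hc s).symm) hWlim
  have hq : ∀ t, z₀ < t → HasDerivAt (fun t => f t / g t) 0 t := fun t ht =>
    ((hf.hasDerivAt t).div (hg.hasDerivAt t) (hpos t ht).ne').congr_deriv (by
      rw [div_eq_zero_iff]; left; linarith [hW0 t])
  have hqlim : Tendsto (fun t => f t / g t) atTop (𝓝 1) := by
    have := hf.tendsto.div hg.tendsto one_ne_zero
    rw [div_one] at this
    exact this.congr fun z => mul_div_mul_left _ _ (Real.exp_pos _).ne'
  have hfg : f z = g z := by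
    have hc : ∀ s, z₀ < s → f s / g s = f z / g z := fun s hs =>
      isOpen_Ioi.is_const_of_deriv_eq_zero (convex_Ioi z₀).isPreconnected
        (fun t ht => (hq t ht).differentiableAt.differentiableWithinAt)
        (fun t ht => (hq t ht).deriv) hs hz
    have := tendsto_nhds_unique (tendsto_const_nhds.congr'
      ((eventually_gt_atTop z₀).mono fun s hs => (hc s hs).symm)) hqlim
    rwa [div_eq_one_iff_eq (hpos z hz).ne'] at this
  refine ⟨hfg, ?_⟩
  have h := hW0 z
  rw [hfg] at h
  have := (hpos z hz).ne'
  have h' : g z * (f' z - g' z) = 0 := by linarith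
  linarith [(mul_eq_zero.1 h').resolve_left this]

end IsJost

/-- The variable `w = (1 - tanh z) / 2`. -/
def hyperVar (z : ℝ) : ℝ := (1 + Real.exp (2 * z))⁻¹

theorem hyperVar_pos (z : ℝ) : 0 < hyperVar z := by unfold hyperVar; positivity

theorem hyperVar_lt_one (z : ℝ) : hyperVar z < 1 :=
  inv_lt_one_of_one_lt₀ (by linarith [Real.exp_pos (2 * z)])

theorem abs_hyperVar_lt_one (z : ℝ) : |hyperVar z| < 1 := by
  rw [abs_of_pos (hyperVar_pos z)]; exact hyperVar_lt_one z

theorem hasDerivAt_hyperVar (z : ℝ) :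
    HasDerivAt hyperVar (-(2 * hyperVar z * (1 - hyperVar z))) z := by
  have h : HasDerivAt (fun z : ℝ => 1 + Real.exp (2 * z)) (Real.exp (2 * z) * (2 * 1)) z :=
    (((hasDerivAt_id z).const_mul 2).exp).const_add 1
  have hne : 1 + Real.exp (2 * z) ≠ 0 := by positivity
  refine (h.inv hne).congr_deriv ?_
  unfold hyperVar
  field_simp
  ring

theorem one_div_cosh_sq (z : ℝ) : 1 / Real.cosh z ^ 2 = 4 * hyperVar z * (1 - hyperVar z) := by
  have e2 : Real.exp (2 * z) = Real.exp z ^ 2 := by rw [← Real.exp_nat_mul]; norm_num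
  have := Real.exp_pos z
  unfold hyperVar
  rw [Real.cosh_eq, Real.exp_neg, e2]
  field_simp
  ring

theorem tendsto_hyperVar : Tendsto hyperVar atTop (𝓝 0) := by
  refine tendsto_inv_atTop_zero.comp (tendsto_atTop_add_const_left _ _ ?_)
  exact Real.tendsto_exp_atTop.comp (tendsto_id.const_mul_atTop two_pos)

/-- The Jost solution. -/
def jost (Λ m z : ℝ) : ℝ := Real.exp (-(m * z)) * hyperSum Λ m (hyperVar z)

/-- The derivative of the Jost solution. -/
def jost' (Λ m z : ℝ) : ℝ :=
  Real.exp (-(m * z)) * (-(m * hyperSum Λ m (hyperVar z)) -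
    2 * hyperVar z * (1 - hyperVar z) * hyperSum' Λ m (hyperVar z))

/-- Since `w' = -2w(1 - w)` and `1 / cosh² = 4w(1 - w)`, the substitution `f = e^{-mz} S(w)` turns
the Pöschl–Teller equation into `4 e^{-mz} w (1 - w)` times the hypergeometric one. As `z → ∞` one
has `w → 0`, so `S 0 = 1` gives the normalization. -/
theorem isJost_jost {Λ m : ℝ} (hΛ : 0 ≤ Λ) (hm : 0 ≤ m) : IsJost Λ m (jost Λ m) (jost' Λ m) := by
  have hexp : ∀ z, HasDerivAt (fun z => Real.exp (-(m * z))) (Real.exp (-(m * z)) * (-(m * 1))) z :=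
    fun z => (((hasDerivAt_id z).const_mul m).neg).exp
  have hS : ∀ z, HasDerivAt (fun z => hyperSum Λ m (hyperVar z))
      (hyperSum' Λ m (hyperVar z) * -(2 * hyperVar z * (1 - hyperVar z))) z := fun z =>
    (hasDerivAt_hyperSum hΛ hm (abs_hyperVar_lt_one z)).comp z (hasDerivAt_hyperVar z)
  have hS' : ∀ z, HasDerivAt (fun z => hyperSum' Λ m (hyperVar z))
      (hyperSum'' Λ m (hyperVar z) * -(2 * hyperVar z * (1 - hyperVar z))) z := fun z =>
    (hasDerivAt_hyperSum' hΛ hm (abs_hyperVar_lt_one z)).comp z (hasDerivAt_hyperVar z)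
  have hSlim : Tendsto (fun z => hyperSum Λ m (hyperVar z)) atTop (𝓝 1) := by
    have h0 : hyperSum Λ m 0 = 1 := by
      rw [hyperSum, tsum_eq_single 0 (fun n hn => by simp [hn])]; simp [hyperCoeff]
    have := (hasDerivAt_hyperSum (w := 0) hΛ hm (by simp)).continuousAt.tendsto
    rw [h0] at this
    exact this.comp tendsto_hyperVar
  have hSlim' : Tendsto (fun z => hyperSum' Λ m (hyperVar z)) atTop (𝓝 (hyperSum' Λ m 0)) :=
    ((hasDerivAt_hyperSum' (w := 0) hΛ hm (by simp)).continuousAt.tendsto).comp tendsto_hyperVar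
  have hcancel : ∀ z, Real.exp (m * z) * Real.exp (-(m * z)) = 1 := fun z => by
    rw [← Real.exp_add]; simp
  refine ⟨fun z => ?_, fun z => ?_, ?_, ?_⟩
  · refine ((hexp z).mul (hS z)).congr_deriv ?_
    unfold jost'
    ring
  · have hv := hasDerivAt_hyperVar z
    have := (hexp z).mul ((((hS z).const_mul m).neg).sub
      ((((hv.const_mul 2).mul (hv.const_sub 1))).mul (hS' z)))
    refine this.congr_deriv ?_
    have hode := hyperSum_ode hΛ hm (abs_hyperVar_lt_one z)
    rw [div_eq_mul_one_div, one_div_cosh_sq]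
    unfold jost
    simp only [Pi.mul_apply, Pi.sub_apply, Pi.neg_apply]
    linear_combination (4 * Real.exp (-(m * z)) * hyperVar z * (1 - hyperVar z)) * hode
  · refine hSlim.congr fun z => ?_
    rw [jost, ← mul_assoc, hcancel, one_mul]
  · have := ((hSlim.const_mul m).neg).sub
      (((tendsto_hyperVar.const_mul 2).mul (tendsto_hyperVar.const_sub 1)).mul hSlim')
    simp only [mul_one, mul_zero, zero_mul, sub_zero] at this
    refine this.congr fun z => ?_
    rw [jost', ← mul_assoc, hcancel, one_mul]

theorem continuousOn_jost {Λ : ℝ} (hΛ : 0 ≤ Λ) (z : ℝ) :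
    ContinuousOn (fun m => jost Λ m z) (Set.Ici 0) :=
  (by fun_prop : Continuous fun m : ℝ => Real.exp (-(m * z))).continuousOn.mul
    (continuousOn_hyperSum hΛ (hyperVar_pos z) (hyperVar_lt_one z))

theorem continuousOn_jost' {Λ : ℝ} (hΛ : 0 ≤ Λ) (z : ℝ) :
    ContinuousOn (fun m => jost' Λ m z) (Set.Ici 0) :=
  (by fun_prop : Continuous fun m : ℝ => Real.exp (-(m * z))).continuousOn.mul
    (((continuousOn_id.mul
      (continuousOn_hyperSum hΛ (hyperVar_pos z) (hyperVar_lt_one z))).neg).sub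
      (continuousOn_const.mul (continuousOn_hyperSum' hΛ (hyperVar_pos z) (hyperVar_lt_one z))))

theorem tendsto_jost_energy {Λ : ℝ} (hΛ : 0 ≤ Λ) (z : ℝ) :
    Tendsto (fun m => Real.exp (m * z) * jost Λ m z) atTop (𝓝 1) := by
  refine (tendsto_hyperSum_atTop hΛ (hyperVar_pos z) (hyperVar_lt_one z)).congr fun m => ?_
  rw [jost, ← mul_assoc, ← Real.exp_add]; simp

theorem tendsto_jost'_energy {Λ : ℝ} (hΛ : 0 ≤ Λ) (z : ℝ) :
    Tendsto (fun m => m⁻¹ * (Real.exp (m * z) * jost' Λ m z)) atTop (𝓝 (-1)) := by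
  have h1 := tendsto_hyperSum_atTop hΛ (hyperVar_pos z) (hyperVar_lt_one z)
  have h2 := (tendsto_hyperSum'_atTop hΛ (hyperVar_pos z) (hyperVar_lt_one z)).const_mul
    (2 * hyperVar z * (1 - hyperVar z))
  have := h1.neg.sub ((tendsto_inv_atTop_zero (𝕜 := ℝ)).mul h2)
  simp only [mul_zero, sub_zero] at this
  refine this.congr' ?_
  filter_upwards [eventually_gt_atTop 0] with m hm
  have e : Real.exp (m * z) * Real.exp (-(m * z)) = 1 := by rw [← Real.exp_add]; simp
  rw [jost', ← mul_assoc (Real.exp _), e, one_mul]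
  field_simp

/-- For `Λ = (1 + m) (2 + m)` the Jost solution is `2^{-m} sech^m tanh`. -/
theorem isJost_explicit {m : ℝ} (hm : 0 < m) : IsJost ((1 + m) * (2 + m)) m
    (fun z => (2 * Real.cosh z) ^ (-m) * Real.tanh z)
    (fun z => (2 * Real.cosh z) ^ (-m) * (1 - (m + 1) * Real.tanh z ^ 2)) := by
  have hc : ∀ z, HasDerivAt (fun z => (2 * Real.cosh z) ^ (-m))
      (-(m * Real.tanh z) * (2 * Real.cosh z) ^ (-m)) z := by
    intro z
    have h0 : 0 < Real.cosh z := Real.cosh_pos z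
    have := ((Real.hasDerivAt_cosh z).const_mul 2).rpow_const (p := -m)
      (Or.inl (by positivity))
    refine this.congr_deriv ?_
    rw [Real.rpow_sub_one (by positivity), Real.tanh_eq_sinh_div_cosh]
    field_simp
  have ht : ∀ z, HasDerivAt Real.tanh (1 - Real.tanh z ^ 2) z := by
    intro z
    have h0 : Real.cosh z ≠ 0 := (Real.cosh_pos z).ne'
    have := (Real.hasDerivAt_sinh z).div (Real.hasDerivAt_cosh z) h0
    have e : Real.tanh = Real.sinh / Real.cosh := by
      ext t; exact Real.tanh_eq_sinh_div_cosh t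
    rw [e]
    refine this.congr_deriv ?_
    simp only [Pi.div_apply]
    field_simp
  have e1 : ∀ z, 1 / Real.cosh z ^ 2 = 1 - Real.tanh z ^ 2 := by
    intro z
    have h0 : Real.cosh z ≠ 0 := (Real.cosh_pos z).ne'
    rw [Real.tanh_eq_sinh_div_cosh]
    field_simp
    linarith [Real.cosh_sq z]
  have hexp0 : Tendsto (fun z : ℝ => Real.exp (-(2 * z))) atTop (𝓝 0) :=
    IsJost.tendsto_exp_neg two_pos
  have hC : Tendsto (fun z => Real.exp (m * z) * (2 * Real.cosh z) ^ (-m)) atTop (𝓝 1) := by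
    have h1 : Tendsto (fun z : ℝ => (1 + Real.exp (-(2 * z))) ^ (-m)) atTop (𝓝 1) := by
      have := (hexp0.const_add 1).rpow_const (p := -m) (Or.inl (by norm_num))
      simpa using this
    refine h1.congr fun z => ?_
    have e : 1 + Real.exp (-(2 * z)) = Real.exp (-z) * (2 * Real.cosh z) := by
      rw [Real.cosh_eq, mul_div_cancel₀ _ two_ne_zero, mul_add, ← Real.exp_add, ← Real.exp_add,
        neg_add_cancel, Real.exp_zero]
      ring_nf
    rw [e, Real.mul_rpow (Real.exp_pos _).le (by have := Real.cosh_pos z; positivity),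
      ← Real.exp_mul]
    ring_nf
  have hT : Tendsto Real.tanh atTop (𝓝 1) := by
    have := (hexp0.const_sub 1).div (hexp0.const_add 1) (by norm_num)
    simp only [sub_zero, add_zero, div_one] at this
    refine this.congr fun z => ?_
    have e : Real.exp (-(2 * z)) = Real.exp (-z) ^ 2 := by
      rw [← Real.exp_nat_mul]; ring_nf
    have := Real.exp_pos z
    simp only [Pi.div_apply]
    rw [e, Real.tanh_eq_sinh_div_cosh, Real.sinh_eq, Real.cosh_eq, Real.exp_neg]
    field_simp
  refine ⟨fun z => ?_, fun z => ?_, ?_, ?_⟩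
  · refine ((hc z).mul (ht z)).congr_deriv ?_
    ring
  · refine ((hc z).mul ((((ht z).pow 2).const_mul (m + 1)).const_sub 1)).congr_deriv ?_
    rw [div_eq_mul_one_div, e1]
    simp only [Pi.pow_apply]
    ring
  · have := hC.mul hT
    simp only [mul_one] at this
    exact this.congr fun z => mul_assoc _ _ _
  · have := hC.mul (((hT.pow 2).const_mul (m + 1)).const_sub 1)
    refine (this.congr fun z => mul_assoc _ _ _).trans_eq ?_
    congr 1; ring

/-! ### Counting the zeros of the matching determinant -/

/-- The determinant of the matching conditions at the origin for the decaying solutions, up to a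
factor. -/
def matchDet (Λ κ z₁ z₂ m : ℝ) : ℝ :=
  jost Λ m z₁ * jost' Λ m z₂ + jost Λ m z₂ * jost' Λ m z₁ + κ * (jost' Λ m z₁ * jost' Λ m z₂)

/-- The logarithmic derivative at `z` of the explicit Jost solution, with the opposite sign. -/
def groundSlope (m z : ℝ) : ℝ := ((m + 1) * Real.tanh z ^ 2 - 1) / Real.tanh z

section

variable {m₀ m m' κ z z₁ z₂ : ℝ}

/-- The explicit solution is, up to a factor, the derivative of `sech^{m₀}`: the translation mode of
the soliton when `m₀ = 1/μ`. Uniqueness of the Jost solution identifies the two. -/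
theorem jost_ground (hm : 0 < m₀) (hz : 0 < z) :
    0 < jost ((1 + m₀) * (2 + m₀)) m₀ z ∧
      jost' ((1 + m₀) * (2 + m₀)) m₀ z / jost ((1 + m₀) * (2 + m₀)) m₀ z = -groundSlope m₀ z := by
  have hT : ∀ t : ℝ, 0 < t → 0 < Real.tanh t := fun t ht => by
    rw [Real.tanh_eq_sinh_div_cosh]
    exact div_pos (Real.sinh_pos_iff.2 ht) (Real.cosh_pos t)
  have hC : ∀ t : ℝ, 0 < (2 * Real.cosh t) ^ (-m₀) := fun t =>
    Real.rpow_pos_of_pos (by have := Real.cosh_pos t; positivity) _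
  obtain ⟨h1, h2⟩ := (isJost_jost (by positivity) hm.le).eq_of_pos (isJost_explicit hm) hm
    (z₀ := 0) (fun t ht => mul_pos (hC t) (hT t ht)) hz
  rw [h1, h2]
  refine ⟨mul_pos (hC z) (hT z hz), ?_⟩
  rw [mul_div_mul_left _ _ (hC z).ne', groundSlope, ← neg_div, neg_sub]

/-- At `m₀` the solution is explicit and positive for `z > 0`; Sturm comparison propagates this to
larger `m`. Positivity makes the slopes well defined. -/
theorem jost_pos (hm₀ : 0 < m₀) (hm : m₀ ≤ m) (hz : 0 < z) :
    0 < jost ((1 + m₀) * (2 + m₀)) m z := by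
  rcases hm.eq_or_lt with rfl | hlt
  · exact (jost_ground hm₀ hz).1
  · exact ((isJost_jost (by positivity) (hm₀.le.trans hm)).comparison
      (isJost_jost (by positivity) hm₀.le) hm₀ hlt
      (fun t ht => (jost_ground hm₀ (hz.trans_le ht)).1)).1 z le_rfl

/-- The quotient `-f' / f` of the Jost solution. -/
def jostSlope (Λ m z : ℝ) : ℝ := -(jost' Λ m z / jost Λ m z)

theorem jostSlope_ground (hm : 0 < m₀) (hz : 0 < z) :
    jostSlope ((1 + m₀) * (2 + m₀)) m₀ z = groundSlope m₀ z := by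
  rw [jostSlope, (jost_ground hm hz).2, neg_neg]

theorem jostSlope_lt (hm₀ : 0 < m₀) (hm' : m₀ ≤ m') (hmm : m' < m) (hz : 0 < z) :
    jostSlope ((1 + m₀) * (2 + m₀)) m' z < jostSlope ((1 + m₀) * (2 + m₀)) m z :=
  neg_lt_neg (((isJost_jost (by positivity) ((hm₀.le.trans hm').trans hmm.le)).comparison
    (isJost_jost (by positivity) (hm₀.le.trans hm')) (hm₀.trans_le hm') hmm
    (fun _ ht => jost_pos hm₀ hm' (hz.trans_le ht))).2 z le_rfl)

theorem jostSlope_le (hm₀ : 0 < m₀) (hm : m₀ ≤ m) (hz : 0 < z) :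
    groundSlope m₀ z ≤ jostSlope ((1 + m₀) * (2 + m₀)) m z := by
  rw [← jostSlope_ground hm₀ hz]
  rcases hm.eq_or_lt with rfl | hlt
  · exact le_rfl
  · exact (jostSlope_lt hm₀ le_rfl hlt hz).le

/-- Used at `z₂`, where a nonzero derivative lets the coefficient on the left determine the one on
the right. -/
theorem jost'_neg (hm₀ : 0 < m₀) (hm : m₀ ≤ m) (hz : 0 < z) (hs : 0 < groundSlope m₀ z) :
    jost' ((1 + m₀) * (2 + m₀)) m z < 0 := by
  have h1 := jost_pos hm₀ hm hz
  have h2 := hs.trans_le (jostSlope_le hm₀ hm hz)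
  rw [jostSlope, ← neg_div] at h2
  linarith [(div_pos_iff_of_pos_right h1).1 h2]

theorem matchDet_eq (hm₀ : 0 < m₀) (hm : m₀ ≤ m) (h₁ : 0 < z₁) (h₂ : 0 < z₂) :
    matchDet ((1 + m₀) * (2 + m₀)) κ z₁ z₂ m =
      jost ((1 + m₀) * (2 + m₀)) m z₁ * jost ((1 + m₀) * (2 + m₀)) m z₂ *
      (κ * (jostSlope ((1 + m₀) * (2 + m₀)) m z₁ * jostSlope ((1 + m₀) * (2 + m₀)) m z₂) -
        (jostSlope ((1 + m₀) * (2 + m₀)) m z₁ + jostSlope ((1 + m₀) * (2 + m₀)) m z₂)) := by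
  have p1 := (jost_pos hm₀ hm h₁).ne'
  have p2 := (jost_pos hm₀ hm h₂).ne'
  unfold matchDet jostSlope
  field_simp
  ring

theorem matchDet_eq_zero_iff (hm₀ : 0 < m₀) (hm : m₀ ≤ m) (h₁ : 0 < z₁) (h₂ : 0 < z₂) :
    matchDet ((1 + m₀) * (2 + m₀)) κ z₁ z₂ m = 0 ↔
      κ * (jostSlope ((1 + m₀) * (2 + m₀)) m z₁ * jostSlope ((1 + m₀) * (2 + m₀)) m z₂) =
        jostSlope ((1 + m₀) * (2 + m₀)) m z₁ + jostSlope ((1 + m₀) * (2 + m₀)) m z₂ := by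
  rw [matchDet_eq hm₀ hm h₁ h₂, mul_eq_zero, or_iff_right
    (mul_pos (jost_pos hm₀ hm h₁) (jost_pos hm₀ hm h₂)).ne', sub_eq_zero]

/-- Multiplying the hypothesis on `κ` by the negative number `g₁ g₂` reverses it. -/
theorem matchDet_ground_neg (hm₀ : 0 < m₀) (h₁ : 0 < z₁) (h₂ : 0 < z₂)
    (hs₁ : groundSlope m₀ z₁ < 0) (hs₂ : 0 < groundSlope m₀ z₂)
    (hκ : (groundSlope m₀ z₁)⁻¹ + (groundSlope m₀ z₂)⁻¹ < κ) :
    matchDet ((1 + m₀) * (2 + m₀)) κ z₁ z₂ m₀ < 0 := by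
  rw [matchDet_eq hm₀ le_rfl h₁ h₂, jostSlope_ground hm₀ h₁, jostSlope_ground hm₀ h₂]
  refine mul_neg_of_pos_of_neg (mul_pos (jost_pos hm₀ le_rfl h₁) (jost_pos hm₀ le_rfl h₂)) ?_
  have hneg := mul_neg_of_neg_of_pos hs₁ hs₂
  have := mul_lt_mul_of_neg_right hκ hneg
  have e : ((groundSlope m₀ z₁)⁻¹ + (groundSlope m₀ z₂)⁻¹) *
      (groundSlope m₀ z₁ * groundSlope m₀ z₂) = groundSlope m₀ z₁ + groundSlope m₀ z₂ := by
    have := hs₁.ne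
    have := hs₂.ne'
    field_simp
    ring
  linarith

/-- Since `f ~ e^{-mz}` and `f' ~ -m e^{-mz}` as `m → ∞`, only the `κ` term survives division by `m²
e^{-m(z₁ + z₂)}`, and the quotient tends to `κ`. -/
theorem eventually_matchDet_pos {Λ : ℝ} (hΛ : 0 ≤ Λ) (hκ : 0 < κ) :
    ∀ᶠ m in atTop, 0 < matchDet Λ κ z₁ z₂ m := by
  have a1 := tendsto_jost_energy hΛ z₁
  have a2 := tendsto_jost_energy hΛ z₂
  have b1 := tendsto_jost'_energy hΛ z₁
  have b2 := tendsto_jost'_energy hΛ z₂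
  have hi := tendsto_inv_atTop_zero (𝕜 := ℝ)
  have := ((hi.mul (a1.mul b2)).add (hi.mul (a2.mul b1))).add ((b1.mul b2).const_mul κ)
  simp only [mul_neg, mul_one, neg_neg, neg_zero, zero_add] at this
  filter_upwards [this.eventually (lt_mem_nhds hκ), eventually_gt_atTop 0] with m h hm
  have e : m⁻¹ * (Real.exp (m * z₁) * jost Λ m z₁ * (m⁻¹ * (Real.exp (m * z₂) * jost' Λ m z₂))) +
      m⁻¹ * (Real.exp (m * z₂) * jost Λ m z₂ * (m⁻¹ * (Real.exp (m * z₁) * jost' Λ m z₁))) +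
      κ * (m⁻¹ * (Real.exp (m * z₁) * jost' Λ m z₁) *
        (m⁻¹ * (Real.exp (m * z₂) * jost' Λ m z₂))) =
      m⁻¹ * m⁻¹ * Real.exp (m * z₁) * Real.exp (m * z₂) * matchDet Λ κ z₁ z₂ m := by
    unfold matchDet; ring
  rw [e] at h
  exact pos_of_mul_pos_right h (by positivity)

theorem existsUnique_matchDet_eq_zero (hm₀ : 0 < m₀) (h₁ : 0 < z₁) (h₂ : 0 < z₂)
    (hs₁ : groundSlope m₀ z₁ < 0) (hs₂ : 0 < groundSlope m₀ z₂) (hκ₀ : 0 < κ)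
    (hκ : (groundSlope m₀ z₁)⁻¹ + (groundSlope m₀ z₂)⁻¹ < κ) :
    ∃! m, m₀ < m ∧ matchDet ((1 + m₀) * (2 + m₀)) κ z₁ z₂ m = 0 := by
  have hΛ : 0 ≤ (1 + m₀) * (2 + m₀) := by positivity
  have hg := matchDet_ground_neg hm₀ h₁ h₂ hs₁ hs₂ hκ
  obtain ⟨M, hMpos, hM⟩ := ((eventually_matchDet_pos (z₁ := z₁) (z₂ := z₂) hΛ hκ₀).and
    (eventually_ge_atTop m₀)).exists
  have hcont : ContinuousOn (matchDet ((1 + m₀) * (2 + m₀)) κ z₁ z₂) (Set.Icc m₀ M) := by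
    have c : ContinuousOn (matchDet ((1 + m₀) * (2 + m₀)) κ z₁ z₂) (Set.Ici 0) :=
      (((continuousOn_jost hΛ z₁).mul (continuousOn_jost' hΛ z₂)).add
        ((continuousOn_jost hΛ z₂).mul (continuousOn_jost' hΛ z₁))).add
        (continuousOn_const.mul ((continuousOn_jost' hΛ z₁).mul (continuousOn_jost' hΛ z₂)))
    exact c.mono fun t ht => hm₀.le.trans ht.1
  obtain ⟨m, hm, hm0⟩ := intermediate_value_Icc hM hcont ⟨hg.le, hMpos.le⟩
  have hlt : m₀ < m := lt_of_le_of_ne hm.1 fun h => hg.ne (h ▸ hm0)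
  have aux : ∀ a b : ℝ, m₀ < a → a < b → matchDet ((1 + m₀) * (2 + m₀)) κ z₁ z₂ a = 0 →
      matchDet ((1 + m₀) * (2 + m₀)) κ z₁ z₂ b = 0 → False := by
    intro a b ha hab hza hzb
    rw [matchDet_eq_zero_iff hm₀ ha.le h₁ h₂] at hza
    rw [matchDet_eq_zero_iff hm₀ (ha.trans hab).le h₁ h₂] at hzb
    have a1 := jostSlope_lt hm₀ le_rfl ha h₁
    have a2 := jostSlope_lt hm₀ le_rfl ha h₂
    have b1 := jostSlope_lt hm₀ ha.le hab h₁
    have b2 := jostSlope_lt hm₀ ha.le hab h₂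
    rw [jostSlope_ground hm₀ h₁] at a1
    rw [jostSlope_ground hm₀ h₂] at a2
    set g₁ := groundSlope m₀ z₁
    set g₂ := groundSlope m₀ z₂
    set p₁ := jostSlope ((1 + m₀) * (2 + m₀)) a z₁
    set p₂ := jostSlope ((1 + m₀) * (2 + m₀)) a z₂
    set q₁ := jostSlope ((1 + m₀) * (2 + m₀)) b z₁
    set q₂ := jostSlope ((1 + m₀) * (2 + m₀)) b z₂
    have hp₂ : 0 < p₂ := hs₂.trans a2
    have hq₂ : 0 < q₂ := hp₂.trans b2
    have inv_of : ∀ x y : ℝ, x ≠ 0 → 0 < y → κ * (x * y) = x + y → x⁻¹ + y⁻¹ = κ := by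
      intro x y hx hy h
      have := hy.ne'
      field_simp
      linarith
    -- A zero slope `p₁` would force `p₂ = 0` in the matching equation.
    have hp₁0 : p₁ ≠ 0 := fun h => by rw [h] at hza; simp at hza; exact hp₂.ne hza
    have ep := inv_of p₁ p₂ hp₁0 hp₂ hza
    -- No root occurs while `p₁ < 0`, as `1/p₁ + 1/p₂` is then below its value at `m₀`, hence below
    -- `κ`. For `p₁ > 0` the sum strictly decreases and cannot equal `κ` at both `a` and `b`.
    rcases lt_or_gt_of_ne hp₁0 with hneg | hpos
    · have i1 : p₁⁻¹ < g₁⁻¹ := (inv_lt_inv_of_neg hneg hs₁).2 a1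
      have i2 : p₂⁻¹ < g₂⁻¹ := (inv_lt_inv₀ hp₂ hs₂).2 a2
      linarith
    · have hq₁ := hpos.trans b1
      have eq := inv_of q₁ q₂ hq₁.ne' hq₂ hzb
      have i1 : q₁⁻¹ < p₁⁻¹ := (inv_lt_inv₀ hq₁ hpos).2 b1
      have i2 : q₂⁻¹ < p₂⁻¹ := (inv_lt_inv₀ hq₂ hp₂).2 b2
      linarith
  refine ⟨m, ⟨hlt, hm0⟩, fun n ⟨hn, hn0⟩ => ?_⟩
  rcases lt_trichotomy n m with h | h | h
  · exact (aux n m hn h hn0 hm0).elim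
  · exact h
  · exact (aux m n hlt h hm0 hn0).elim

end

/-! ### Weak derivatives on the half-line -/

/-- `g` is the weak derivative of `f` on `(0, ∞)`. -/
def HasWeakDerivPos (f g : ℝ → ℂ) : Prop :=
  ∀ φ : ℝ → ℝ, ContDiff ℝ ((⊤ : ℕ∞) : WithTop ℕ∞) φ → HasCompactSupport φ →
    tsupport φ ⊆ Set.Ioi 0 → ∫ x, deriv φ x • f x = -∫ x, φ x • g x

/-- A primitive of a locally integrable function is absolutely continuous with derivative `g` almost
everywhere, so integration by parts applies on an interval containing the support of `φ`; the
boundary terms vanish. -/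
theorem integral_deriv_mul_primitive {g φ : ℝ → ℝ} (hg : LocallyIntegrable g volume)
    (hφ : ContDiff ℝ 1 φ) (hc : HasCompactSupport φ) :
    ∫ x, deriv φ x * (∫ t in (0 : ℝ)..x, g t) = -∫ x, φ x * g x := by
  obtain ⟨R, hR0, hR⟩ : ∃ R : ℝ, 0 < R ∧ tsupport φ ⊆ Set.Ioo (-R) R := by
    obtain ⟨r, hr⟩ := hc.isCompact.isBounded.subset_ball 0
    refine ⟨max r 1, by positivity, fun x hx => ?_⟩
    have := hr hx
    rw [mem_ball_zero_iff, Real.norm_eq_abs, abs_lt] at this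
    exact ⟨by linarith [le_max_left r 1], by linarith [le_max_left r 1]⟩
  have hle : -R ≤ R := by linarith
  have hz : ∀ x, x ∉ Set.Ioo (-R) R → φ x = 0 := fun x hx =>
    image_eq_zero_of_notMem_tsupport fun h => hx (hR h)
  have hint : ∀ a b, IntervalIntegrable g volume a b := fun a b =>
    (hg.integrableOn_isCompact isCompact_uIcc).intervalIntegrable
  have hF := (hint (-R) R).absolutelyContinuousOnInterval_intervalIntegral (c := 0)
    (by rw [Set.uIcc_of_le hle]; exact ⟨by linarith, hR0.le⟩)
  have hφac : AbsolutelyContinuousOnInterval φ (-R) R :=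
    hφ.contDiffOn.absolutelyContinuousOnInterval
  have key := hφac.integral_mul_deriv_eq_deriv_mul hF
  rw [hz R (by simp), hz (-R) (by simp), zero_mul, zero_mul, sub_zero, zero_sub] at key
  have e1 : ∫ x in (-R)..R, φ x * deriv (fun x => ∫ t in (0 : ℝ)..x, g t) x =
      ∫ x in (-R)..R, φ x * g x := by
    refine intervalIntegral.integral_congr_ae ?_
    filter_upwards [_root_.LocallyIntegrable.ae_hasDerivAt_integral hg] with x hx _
    rw [(hx 0).deriv]
  have s1 : ∫ x in (-R)..R, φ x * g x = ∫ x, φ x * g x := by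
    refine intervalIntegral.integral_eq_integral_of_support_subset fun x hx => ?_
    exact Set.Ioo_subset_Ioc_self (hR (subset_tsupport φ (left_ne_zero_of_mul hx)))
  have s2 : ∫ x in (-R)..R, deriv φ x * (∫ t in (0 : ℝ)..x, g t) =
      ∫ x, deriv φ x * (∫ t in (0 : ℝ)..x, g t) := by
    refine intervalIntegral.integral_eq_integral_of_support_subset fun x hx => ?_
    exact Set.Ioo_subset_Ioc_self (hR (tsupport_deriv_subset (𝕜 := ℝ)
      (subset_tsupport _ (left_ne_zero_of_mul hx))))
  rw [e1, s1, s2] at key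
  linarith

theorem continuous_primitive_of_locallyIntegrable {g : ℝ → ℂ}
    (hg : LocallyIntegrable g volume) : Continuous fun x => ∫ t in (0 : ℝ)..x, g t :=
  intervalIntegral.continuous_primitive
    (fun _ _ => (hg.integrableOn_isCompact isCompact_uIcc).intervalIntegrable) 0

theorem integral_deriv_smul_primitive {g : ℝ → ℂ} {φ : ℝ → ℝ} (hg : LocallyIntegrable g volume)
    (hφ : ContDiff ℝ 1 φ) (hc : HasCompactSupport φ) :
    ∫ x, deriv φ x • (∫ t in (0 : ℝ)..x, g t) = -∫ x, φ x • g x := by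
  have hint : ∀ a b, IntervalIntegrable g volume a b := fun a b =>
    (hg.integrableOn_isCompact isCompact_uIcc).intervalIntegrable
  have hd : Continuous (deriv φ) := hφ.continuous_deriv le_rfl
  have hi1 : Integrable fun x => deriv φ x • (∫ t in (0 : ℝ)..x, g t) :=
    (hd.smul (continuous_primitive_of_locallyIntegrable hg)).integrable_of_hasCompactSupport
      hc.deriv.smul_right
  have hi2 : Integrable fun x => φ x • g x :=
    hg.integrable_smul_left_of_hasCompactSupport hφ.continuous hc
  have aux : ∀ L : ℂ →L[ℝ] ℝ, L (∫ x, deriv φ x • (∫ t in (0 : ℝ)..x, g t)) =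
      L (-∫ x, φ x • g x) := by
    intro L
    rw [map_neg, ← L.integral_comp_comm hi1, ← L.integral_comp_comm hi2]
    have hLg : LocallyIntegrable (fun x => L (g x)) volume := fun x => by
      obtain ⟨s, hs, h⟩ := hg x
      exact ⟨s, hs, L.integrable_comp h⟩
    rw [← (funext fun x => by rw [map_smul, smul_eq_mul] :
        (fun x => φ x * L (g x)) = fun x => L (φ x • g x)),
      ← integral_deriv_mul_primitive hLg hφ hc]
    refine integral_congr_ae (ae_of_all _ fun x => ?_)
    simp only [map_smul, smul_eq_mul]
    rw [L.intervalIntegral_comp_comm (hint 0 x)]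
  exact Complex.ext (aux Complex.reCLM) (aux Complex.imCLM)

/-- The du Bois-Reymond lemma on `(0, ∞)`. -/
theorem ae_eq_const_of_integral_deriv_smul_eq_zero {h : ℝ → ℂ} (hh : LocallyIntegrable h volume)
    (H : ∀ φ : ℝ → ℝ, ContDiff ℝ ((⊤ : ℕ∞) : WithTop ℕ∞) φ → HasCompactSupport φ →
      tsupport φ ⊆ Set.Ioi 0 → ∫ x, deriv φ x • h x = 0) :
    ∃ c : ℂ, ∀ᵐ x, x ∈ Set.Ioi (0 : ℝ) → h x = c := by
  let bump : ContDiffBump (2 : ℝ) := ⟨1 / 2, 1, by norm_num, by norm_num⟩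
  set ρ : ℝ → ℝ := bump.normed volume with hρ
  have ρsm : ContDiff ℝ ((⊤ : ℕ∞) : WithTop ℕ∞) ρ := bump.contDiff_normed
  have ρc : HasCompactSupport ρ := bump.hasCompactSupport_normed
  have ρint : ∫ x, ρ x = 1 := bump.integral_normed
  have ρsupp : tsupport ρ = Metric.closedBall 2 1 := bump.tsupport_normed_eq
  refine ⟨∫ x, ρ x • h x, ?_⟩
  have hl : LocallyIntegrable (fun x => h x - ∫ x, ρ x • h x) volume :=
    hh.sub (locallyIntegrable_const _)
  have key := isOpen_Ioi.ae_eq_zero_of_integral_contDiff_smul_eq_zero (U := Set.Ioi (0 : ℝ))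
    (hl.locallyIntegrableOn _) fun ψ ψsm ψc ψs => ?_
  · filter_upwards [key] with x hx hx0
    exact sub_eq_zero.1 (hx hx0)
  set I : ℝ := ∫ x, ψ x with hI
  -- Removing the mean of `ψ` makes it the derivative of a test function supported in `(0, ∞)`; the
  -- constant is then the `ρ`-average of `h`.
  set η : ℝ → ℝ := fun x => ψ x - I * ρ x with hη
  have ηsm : ContDiff ℝ ((⊤ : ℕ∞) : WithTop ℕ∞) η := ψsm.sub (contDiff_const.mul ρsm)
  have ηcont := ηsm.continuous
  set K := tsupport ψ ∪ Metric.closedBall (2 : ℝ) 1 with hK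
  have Kc : IsCompact K := ψc.isCompact.union (isCompact_closedBall 2 1)
  have Kne : K.Nonempty := ⟨2, Or.inr (Metric.mem_closedBall_self zero_le_one)⟩
  have Kpos : K ⊆ Set.Ioi 0 := Set.union_subset ψs fun x hx => by
    rw [Metric.mem_closedBall, Real.dist_eq, abs_le] at hx
    rw [Set.mem_Ioi]; linarith [hx.1]
  obtain ⟨a, haK, ha⟩ := Kc.exists_isLeast Kne
  obtain ⟨b, hbK, hb⟩ := Kc.exists_isGreatest Kne
  have a0 : 0 < a := Kpos haK
  have ηz : ∀ x, x ∉ Set.Icc a b → η x = 0 := by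
    intro x hx
    have hxK : x ∉ K := fun h => hx ⟨ha h, hb h⟩
    have e1 : ψ x = 0 := image_eq_zero_of_notMem_tsupport fun h => hxK (Or.inl h)
    have e2 : ρ x = 0 := image_eq_zero_of_notMem_tsupport fun h => hxK (Or.inr (ρsupp ▸ h))
    simp [hη, e1, e2]
  have ψi : Integrable ψ := ψsm.continuous.integrable_of_hasCompactSupport ψc
  have ρi : Integrable ρ := ρsm.continuous.integrable_of_hasCompactSupport ρc
  have ηint : ∫ x, η x = 0 := by
    simp only [hη]
    rw [integral_sub ψi (ρi.const_mul I), integral_const_mul, ρint, mul_one, sub_self]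
  set φ : ℝ → ℝ := fun x => ∫ t in (0 : ℝ)..x, η t with hφ
  have φd : ∀ x, HasDerivAt φ (η x) x := fun x =>
    intervalIntegral.integral_hasDerivAt_right (ηcont.intervalIntegrable _ _)
      (ηcont.stronglyMeasurableAtFilter _ _) ηcont.continuousAt
  have φderiv : deriv φ = η := funext fun x => (φd x).deriv
  have φsm : ContDiff ℝ ((⊤ : ℕ∞) : WithTop ℕ∞) φ := by
    rw [contDiff_infty_iff_deriv]
    exact ⟨fun x => (φd x).differentiableAt, φderiv ▸ ηsm⟩
  -- Left of `a` the integrand vanishes; right of `b` the primitive equals the total integral of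
  -- `η`, which is zero.
  have φz : ∀ x, x ∉ Set.Icc a b → φ x = 0 := by
    intro x hx
    by_cases hxa : x < a
    · refine (intervalIntegral.integral_congr (g := fun _ => (0 : ℝ)) fun t ht => ?_).trans (by simp)
      refine ηz t fun h => ?_
      have : t ≤ max 0 x := ht.2
      rcases le_max_iff.1 this with h' | h' <;> linarith [h.1]
    · have hxb : b < x := by
        by_contra! h'
        exact hx ⟨not_lt.1 hxa, h'⟩
      refine Eq.trans ?_ ηint
      refine intervalIntegral.integral_eq_integral_of_support_subset fun t ht => ?_
      have : t ∈ Set.Icc a b := by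
        by_contra h'
        exact ht (ηz t h')
      exact ⟨a0.trans_le this.1, this.2.trans hxb.le⟩
  have φsub : tsupport φ ⊆ Set.Icc a b := closure_minimal (fun x hx => by
    by_contra h'
    exact hx (φz x h')) isClosed_Icc
  have hmain := H φ φsm (isCompact_Icc.of_isClosed_subset (isClosed_tsupport φ) φsub)
    fun x hx => a0.trans_le (φsub hx).1
  rw [φderiv] at hmain
  have i1 : Integrable fun x => ψ x • h x :=
    hh.integrable_smul_left_of_hasCompactSupport ψsm.continuous ψc
  have i2 : Integrable fun x => ρ x • h x :=
    hh.integrable_smul_left_of_hasCompactSupport ρsm.continuous ρc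
  simp only [hη, sub_smul, mul_smul] at hmain
  have e := (integral_sub i1 (i2.smul I)).symm.trans hmain
  simp only [Pi.smul_apply] at e
  rw [integral_smul] at e
  simp only [smul_sub]
  rw [integral_sub i1 (ψi.smul_const _), integral_smul_const]
  exact e

theorem HasWeakDerivPos.exists_primitive {f g : ℝ → ℂ} (h : HasWeakDerivPos f g)
    (hf : LocallyIntegrable f volume) (hg : LocallyIntegrable g volume) :
    ∃ c : ℂ, ∀ᵐ x, x ∈ Set.Ioi (0 : ℝ) → f x = c + ∫ t in (0 : ℝ)..x, g t := by
  have hcont := continuous_primitive_of_locallyIntegrable hg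
  obtain ⟨c, hc⟩ := ae_eq_const_of_integral_deriv_smul_eq_zero
    (hf.sub hcont.locallyIntegrable) fun φ hφ hφc hφs => by
      have hd : Continuous (deriv φ) := hφ.continuous_deriv (by simp)
      simp only [Pi.sub_apply, smul_sub]
      rw [integral_sub (hf.integrable_smul_left_of_hasCompactSupport hd hφc.deriv)
        (hcont.locallyIntegrable.integrable_smul_left_of_hasCompactSupport hd hφc.deriv),
        h φ hφ hφc hφs, integral_deriv_smul_primitive hg (hφ.of_le (by simp)) hφc, sub_self]
  refine ⟨c, ?_⟩
  filter_upwards [hc] with x hx hx0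
  have := hx hx0
  simp only [Pi.sub_apply] at this
  rw [← this]; ring

/-! ### Square integrable solutions of a second order equation on the half-line -/

theorem integral_eq_of_ae_eq_Ioi {f g : ℝ → ℂ} (h : ∀ᵐ x, x ∈ Set.Ioi (0 : ℝ) → f x = g x)
    {x : ℝ} (hx : 0 < x) : ∫ t in (0 : ℝ)..x, f t = ∫ t in (0 : ℝ)..x, g t := by
  refine intervalIntegral.integral_congr_ae ?_
  filter_upwards [h] with t ht htx
  rw [Set.uIoc_of_le hx.le] at htx
  exact ht htx.1

/-- Limits along this filter are unique because every interval `(0, b)` has positive measure, so the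
filter is nontrivial. -/
theorem tendsto_unique_ae_right {f g : ℝ → ℂ} {a : ℂ} (hg : Continuous g)
    (h : ∀ᵐ x, x ∈ Set.Ioi (0 : ℝ) → f x = g x)
    (hf : Tendsto f (𝓝[>] 0 ⊓ ae volume) (𝓝 a)) : a = g 0 := by
  have hne : (𝓝[>] (0 : ℝ) ⊓ ae volume).NeBot := by
    rw [inf_neBot_iff]
    intro s hs t ht
    obtain ⟨b, hb, hbs⟩ := mem_nhdsGT_iff_exists_Ioo_subset.1 hs
    by_contra hemp
    rw [Set.not_nonempty_iff_eq_empty] at hemp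
    have hsub : Set.Ioo 0 b ⊆ tᶜ := fun x hx hxt => by
      have : x ∈ s ∩ t := ⟨hbs hx, hxt⟩
      rw [hemp] at this; exact this
    have hz : volume (Set.Ioo 0 b) = 0 := measure_mono_null hsub (mem_ae_iff.1 ht)
    rw [Real.volume_Ioo, sub_zero, ENNReal.ofReal_eq_zero] at hz
    exact absurd hb (not_lt.2 hz)
  have hg0 : Tendsto g (𝓝[>] 0 ⊓ ae volume) (𝓝 (g 0)) :=
    (hg.tendsto 0).mono_left (inf_le_left.trans nhdsWithin_le_nhds)
  refine tendsto_nhds_unique (hf.congr' ?_) hg0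
  have h1 : ∀ᶠ x in 𝓝[>] (0 : ℝ) ⊓ ae volume, x ∈ Set.Ioi (0 : ℝ) :=
    eventually_mem_nhdsWithin.filter_mono inf_le_left
  filter_upwards [h1, h.filter_mono inf_le_right] with x hx hx'
  exact hx' hx

/-- A square integrable solution of `f'' = p f` on `(0, ∞)` is a multiple of a given positive square
integrable solution. -/
theorem eq_const_mul_of_weak_solution {f f₁ f₂ : ℝ → ℂ} {p s s' : ℝ → ℝ}
    (hf : MemLp f 2 volume) (hf₁ : MemLp f₁ 2 volume) (hf₂ : MemLp f₂ 2 volume)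
    (h₁ : HasWeakDerivPos f f₁) (h₂ : HasWeakDerivPos f₁ f₂)
    (hp : Continuous p) (heq : ∀ᵐ x, x ∈ Set.Ioi (0 : ℝ) → f₂ x = (p x : ℂ) * f x)
    (hs : ∀ x, HasDerivAt s (s' x) x) (hs' : ∀ x, HasDerivAt s' (p x * s x) x)
    (hpos : ∀ x, 0 ≤ x → 0 < s x)
    (hsL : MemLp s 2 (volume.restrict (Set.Ioi 0)))
    (hsL' : MemLp s' 2 (volume.restrict (Set.Ioi 0)))
    {a d : ℂ} (ha : Tendsto f (𝓝[>] 0 ⊓ ae volume) (𝓝 a))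
    (hd : Tendsto f₁ (𝓝[>] 0 ⊓ ae volume) (𝓝 d)) :
    ∃ c : ℂ, (∀ᵐ x, x ∈ Set.Ioi (0 : ℝ) → f x = c * s x) ∧ a = c * s 0 ∧ d = c * s' 0 := by
  have lf := hf.locallyIntegrable (by norm_num)
  have lf₁ := hf₁.locallyIntegrable (by norm_num)
  have lf₂ := hf₂.locallyIntegrable (by norm_num)
  obtain ⟨c₁, hU⟩ := h₁.exists_primitive lf lf₁
  obtain ⟨c₂, hV⟩ := h₂.exists_primitive lf₁ lf₂
  set U : ℝ → ℂ := fun x => c₁ + ∫ t in (0 : ℝ)..x, f₁ t with hUdef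
  set V : ℝ → ℂ := fun x => c₂ + ∫ t in (0 : ℝ)..x, f₂ t with hVdef
  have Uc : Continuous U := continuous_const.add (continuous_primitive_of_locallyIntegrable lf₁)
  have Vc : Continuous V := continuous_const.add (continuous_primitive_of_locallyIntegrable lf₂)
  have hpC : Continuous fun x => (p x : ℂ) := Complex.continuous_ofReal.comp hp
  have prim : ∀ (g G : ℝ → ℂ) (c : ℂ), Continuous G →
      (∀ᵐ x, x ∈ Set.Ioi (0 : ℝ) → g x = G x) → ∀ x, 0 < x →
      HasDerivAt (fun x => c + ∫ t in (0 : ℝ)..x, g t) (G x) x := by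
    intro g G c hG hgG x hx
    have : HasDerivAt (fun x => c + ∫ t in (0 : ℝ)..x, G t) (G x) x :=
      (intervalIntegral.integral_hasDerivAt_right (hG.intervalIntegrable _ _)
        (hG.stronglyMeasurableAtFilter _ _) hG.continuousAt).const_add c
    refine this.congr_of_eventuallyEq ?_
    filter_upwards [lt_mem_nhds hx] with y hy
    rw [integral_eq_of_ae_eq_Ioi hgG hy]
  -- Bootstrapping: the integrands agree almost everywhere with continuous functions, so the
  -- primitives are classically differentiable.
  have dU : ∀ x, 0 < x → HasDerivAt U (V x) x := prim f₁ V c₁ Vc hV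
  have dV : ∀ x, 0 < x → HasDerivAt V ((p x : ℂ) * U x) x :=
    prim f₂ (fun x => (p x : ℂ) * U x) c₂ (hpC.mul Uc) (by
      filter_upwards [heq, hU] with x h1 h2 hx
      rw [h1 hx, h2 hx])
  have sc : Continuous fun x => (s x : ℂ) := Complex.continuous_ofReal.comp
    (continuous_iff_continuousAt.2 fun x => (hs x).continuousAt)
  have sc' : Continuous fun x => (s' x : ℂ) := Complex.continuous_ofReal.comp
    (continuous_iff_continuousAt.2 fun x => (hs' x).continuousAt)
  have dW : ∀ x, 0 < x → HasDerivAt (fun x => (s x : ℂ) * V x - s' x * U x) 0 x := by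
    intro x hx
    refine (((hs x).ofReal_comp.mul (dV x hx)).sub
      ((hs' x).ofReal_comp.mul (dU x hx))).congr_deriv ?_
    push_cast; ring
  -- The Wronskian is constant, and integrable on `(0, ∞)` as a combination of products of square
  -- integrable functions. A constant integrable over a set of infinite measure is zero, so no
  -- pointwise decay of `f` is needed.
  have W0 : ∀ x, 0 < x → (s x : ℂ) * V x - s' x * U x = 0 := by
    have hconst : ∀ x, 0 < x → ∀ y, 0 < y → (s y : ℂ) * V y - s' y * U y =
        (s x : ℂ) * V x - s' x * U x := fun x hx y hy =>
      isOpen_Ioi.is_const_of_deriv_eq_zero (convex_Ioi 0).isPreconnected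
        (fun t ht => (dW t ht).differentiableAt.differentiableWithinAt)
        (fun t ht => (dW t ht).deriv) hy hx
    intro x hx
    have m0 := hsL.ofReal (K := ℂ)
    have m1 := hsL'.ofReal (K := ℂ)
    have hint : IntegrableOn (fun t => (s t : ℂ) * f₁ t - s' t * f t) (Set.Ioi 0) :=
      (m0.integrable_mul (hf₁.restrict _)).sub (m1.integrable_mul (hf.restrict _))
    have hint' : IntegrableOn (fun _ : ℝ => (s x : ℂ) * V x - s' x * U x) (Set.Ioi 0) := by
      refine hint.congr ?_
      rw [EventuallyEq, ae_restrict_iff' measurableSet_Ioi]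
      filter_upwards [hU, hV] with t h1 h2 ht
      rw [h1 ht, h2 ht]
      exact hconst x hx t ht
    rw [integrableOn_const_iff] at hint'
    rcases hint' with h | h
    · exact enorm_eq_zero.1 h
    · simp at h
  have dq : ∀ x, 0 < x → HasDerivAt (fun x => U x / (s x : ℂ)) 0 x := by
    intro x hx
    have hne : (s x : ℂ) ≠ 0 := Complex.ofReal_ne_zero.2 (hpos x hx.le).ne'
    refine ((dU x hx).div (hs x).ofReal_comp hne).congr_deriv ?_
    rw [div_eq_zero_iff]; left
    linear_combination W0 x hx
  have U_eq : ∀ x, 0 < x → U x = U 1 / s 1 * s x := by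
    intro x hx
    have hne : (s x : ℂ) ≠ 0 := Complex.ofReal_ne_zero.2 (hpos x hx.le).ne'
    have := isOpen_Ioi.is_const_of_deriv_eq_zero (convex_Ioi (0 : ℝ)).isPreconnected
        (fun t ht => (dq t ht).differentiableAt.differentiableWithinAt)
        (fun t ht => (dq t ht).deriv) hx (Set.mem_Ioi.2 one_pos)
    rw [← this]; field_simp
  have V_eq : ∀ x, 0 < x → V x = U 1 / s 1 * s' x := by
    intro x hx
    have hne : (s x : ℂ) ≠ 0 := Complex.ofReal_ne_zero.2 (hpos x hx.le).ne'
    refine mul_left_cancel₀ hne ?_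
    have := W0 x hx
    rw [U_eq x hx] at this
    linear_combination this
  have hfU : ∀ᵐ x, x ∈ Set.Ioi (0 : ℝ) → f x = U 1 / s 1 * s x := by
    filter_upwards [hU] with x h hx
    rw [h hx]; exact U_eq x hx
  have hfV : ∀ᵐ x, x ∈ Set.Ioi (0 : ℝ) → f₁ x = U 1 / s 1 * s' x := by
    filter_upwards [hV] with x h hx
    rw [h hx]; exact V_eq x hx
  exact ⟨U 1 / s 1, hfU, tendsto_unique_ae_right (continuous_const.mul sc) hfU ha,
    tendsto_unique_ae_right (continuous_const.mul sc') hfV hd⟩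

/-! ### Reflection -/

theorem IsWeakDeriv.hasWeakDerivPos {f g : L2} (h : IsWeakDeriv f g) : HasWeakDerivPos f g :=
  fun φ hφ hc hs => h φ hφ hc fun _ hx => ne_of_gt (hs hx)

theorem HasWeakDerivPos.neg {f g : ℝ → ℂ} (h : HasWeakDerivPos f g) :
    HasWeakDerivPos (fun x => -f x) (fun x => -g x) := by
  intro φ hφ hc hs
  simp only [smul_neg, integral_neg]
  rw [h φ hφ hc hs]

theorem IsWeakDeriv.hasWeakDerivPos_reflect {f g : L2} (h : IsWeakDeriv f g) :
    HasWeakDerivPos (fun x => f (-x)) (fun x => -g (-x)) := by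
  intro φ hφ hc hs
  have hsupp : tsupport (fun x => φ (-x)) ⊆ {0}ᶜ := by
    intro x hx
    have hx' : -x ∈ tsupport φ := by
      have := tsupport_comp_subset_preimage φ (f := fun x : ℝ => -x) continuous_neg hx
      exact this
    have := hs hx'
    simp only [Set.mem_Ioi, Left.neg_pos_iff] at this
    exact ne_of_lt this
  have key := h (fun x => φ (-x)) (hφ.comp contDiff_neg)
    (hc.comp_homeomorph (Homeomorph.neg ℝ)) hsupp
  have hd : ∀ x, deriv (fun x => φ (-x)) x = -deriv φ (-x) := fun x => deriv_comp_neg φ x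
  simp only [hd, neg_smul, integral_neg] at key
  rw [← integral_neg_eq_self, ← integral_neg_eq_self (fun x => φ x • -g (-x))]
  simp only [neg_neg, smul_neg, integral_neg]
  exact neg_injective key

theorem quasiMeasurePreserving_neg_real :
    Measure.QuasiMeasurePreserving (fun x : ℝ => -x) volume volume :=
  (Measure.measurePreserving_neg (volume : Measure ℝ)).quasiMeasurePreserving

theorem HasLeftTrace.reflect {f : L2} {b : ℂ} (h : HasLeftTrace f b) :
    Tendsto (fun x => f (-x)) (𝓝[>] 0 ⊓ ae volume) (𝓝 b) := by
  refine Tendsto.comp h (tendsto_inf.2 ⟨Tendsto.mono_left ?_ inf_le_left,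
    quasiMeasurePreserving_neg_real.tendsto_ae.mono_left inf_le_right⟩)
  have := tendsto_neg_nhdsGT (a := (0 : ℝ))
  rwa [neg_zero] at this

/-! ### The eigenvalue equation -/

theorem mem_eigenspaceOf_linearizedL1 {γ ω μ lam : ℝ} {ψ : ℝ → ℂ}
    (hψ : MemLp (linearizedPotential μ lam ψ) ∞ volume)
    (u : (linearizedL1 γ ω μ lam ψ hψ).domain) {u' u'' : L2} (h : IsH2With (u : L2) u' u'')
    (ν : ℝ) : u ∈ eigenspaceOf (linearizedL1 γ ω μ lam ψ hψ) ν ↔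
      ∀ᵐ x, u'' x = ((ω - ν : ℝ) - linearizedPotential μ lam ψ x) * (u : L2) x := by
  have e0 : u ∈ eigenspaceOf (linearizedL1 γ ω μ lam ψ hψ) ν ↔
      (linearizedL1 γ ω μ lam ψ hψ).toFun u = (ν : ℂ) • (u : L2) := by
    unfold eigenspaceOf
    rw [LinearMap.mem_ker, LinearMap.sub_apply, sub_eq_zero]
    rfl
  have e1 : (linearizedL1 γ ω μ lam ψ hψ).toFun u = -u'' + (ω : ℂ) • (u : L2)
      - (hψ.toLp (linearizedPotential μ lam ψ) • (u : L2) : L2) := by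
    rw [← secondDeriv_eq (γ := γ) (u := u) h]
    rfl
  rw [e0, e1, Lp.ext_iff]
  have c1 := Lp.coeFn_sub (-u'' + (ω : ℂ) • (u : L2))
    (hψ.toLp (linearizedPotential μ lam ψ) • (u : L2) : L2)
  have c2 := Lp.coeFn_add (-u'') ((ω : ℂ) • (u : L2))
  have c3 := Lp.coeFn_neg u''
  have c4 := Lp.coeFn_smul (ω : ℂ) (u : L2)
  have c5 := Lp.coeFn_smul (ν : ℂ) (u : L2)
  have c6 := Lp.coeFn_lpSMul (r := 2) (hψ.toLp (linearizedPotential μ lam ψ)) (u : L2)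
  have c7 := hψ.coeFn_toLp
  refine ⟨fun hx => ?_, fun hx => ?_⟩
  · filter_upwards [hx, c1, c2, c3, c4, c5, c6, c7] with x hx c1 c2 c3 c4 c5 c6 c7
    rw [c1, c5] at hx
    simp only [Pi.sub_apply, Pi.smul_apply, smul_eq_mul] at hx
    rw [c2, c6] at hx
    simp only [Pi.add_apply, Pi.smul_apply', smul_eq_mul] at hx
    rw [c3, c4, c7] at hx
    simp only [Pi.neg_apply, Pi.smul_apply, smul_eq_mul] at hx
    push_cast
    linear_combination -hx
  · filter_upwards [hx, c1, c2, c3, c4, c5, c6, c7] with x hx c1 c2 c3 c4 c5 c6 c7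
    rw [c1, c5]
    simp only [Pi.sub_apply, Pi.smul_apply, smul_eq_mul]
    rw [c2, c6]
    simp only [Pi.add_apply, Pi.smul_apply', smul_eq_mul]
    rw [c3, c4, c7]
    simp only [Pi.neg_apply, Pi.smul_apply, smul_eq_mul]
    push_cast at hx
    linear_combination -hx

/-! ### Gluing functions at the origin -/

/-- The product `φ F` is differentiable everywhere, at `0` because `φ` vanishes nearby, so its
derivative integrates to zero whatever the jump of `F`. -/
theorem isWeakDeriv_toLp {F G : ℝ → ℂ} (hF : MemLp F 2 volume) (hG : MemLp G 2 volume)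
    (hd : ∀ x, x ≠ 0 → HasDerivAt F (G x) x) : IsWeakDeriv (hF.toLp F) (hG.toLp G) := by
  intro φ hφ hc hs
  have hdc : Continuous (deriv φ) := hφ.continuous_deriv (by simp)
  have lF := hF.locallyIntegrable (by norm_num)
  have lG := hG.locallyIntegrable (by norm_num)
  have e1 : ∫ x, deriv φ x • (hF.toLp F) x = ∫ x, deriv φ x • F x := by
    refine integral_congr_ae ?_
    filter_upwards [hF.coeFn_toLp] with x hx
    rw [hx]
  have e2 : ∫ x, φ x • (hG.toLp G) x = ∫ x, φ x • G x := by
    refine integral_congr_ae ?_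
    filter_upwards [hG.coeFn_toLp] with x hx
    rw [hx]
  have i0 : Integrable fun x => φ x • F x :=
    lF.integrable_smul_left_of_hasCompactSupport hφ.continuous hc
  have i1 : Integrable fun x => deriv φ x • F x :=
    lF.integrable_smul_left_of_hasCompactSupport hdc hc.deriv
  have i2 : Integrable fun x => φ x • G x :=
    lG.integrable_smul_left_of_hasCompactSupport hφ.continuous hc
  have hφd : ∀ x, HasDerivAt φ (deriv φ x) x := fun x =>
    (hφ.differentiable (by simp) x).hasDerivAt
  have key := integral_eq_zero_of_hasDerivAt_of_integrable
    (f := fun x => φ x • F x) (f' := fun x => deriv φ x • F x + φ x • G x) (fun x => ?_)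
    (i1.add i2) i0
  · rw [integral_add i1 i2] at key
    rw [e1, e2]
    exact eq_neg_of_add_eq_zero_left key
  · by_cases hx : x = 0
    · subst hx
      have h0 : φ =ᶠ[𝓝 0] 0 :=
        notMem_tsupport_iff_eventuallyEq.1 fun h => hs h rfl
      have h1 : deriv φ 0 = 0 := by rw [h0.deriv_eq]; simp
      have h2 : (fun x => φ x • F x) =ᶠ[𝓝 0] fun _ => 0 := by
        filter_upwards [h0] with x hx
        rw [hx]; simp
      rw [h1, h0.eq_of_nhds]
      simpa using (hasDerivAt_const (0 : ℝ) (0 : ℂ)).congr_of_eventuallyEq h2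
    · refine ((hφd x).smul (hd x hx)).congr_deriv ?_
      rw [add_comm]

/-- The function equal to `x ↦ f (-x)` on the negative half-line and to `g` on the positive one. -/
def glue (f g : ℝ → ℝ) (x : ℝ) : ℂ := if x < 0 then (f (-x) : ℂ) else (g x : ℂ)

theorem memLp_glue {f g : ℝ → ℝ} (hf : MemLp f 2 (volume.restrict (Set.Ioi 0)))
    (hg : MemLp g 2 (volume.restrict (Set.Ioi 0))) : MemLp (glue f g) 2 volume := by
  have hf' : MemLp (fun x => ((f (-x) : ℝ) : ℂ)) 2 (volume.restrict (Set.Iio 0)) := by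
    have hp := (Measure.measurePreserving_neg (volume : Measure ℝ)).restrict_preimage
      (measurableSet_Ioi (a := (0 : ℝ)))
    rw [show (Neg.neg ⁻¹' Set.Ioi (0 : ℝ)) = Set.Iio 0 by ext x; simp] at hp
    exact (hf.comp_measurePreserving hp).ofReal
  have hg' : MemLp (fun x => (g x : ℂ)) 2 (volume.restrict (Set.Iio (0 : ℝ))ᶜ) := by
    rw [Set.compl_Iio, ← restrict_Ioi_eq_restrict_Ici]
    exact hg.ofReal
  have := MemLp.piecewise (measurableSet_Iio (a := (0 : ℝ))) hf' hg'
  refine this.ae_eq (ae_of_all _ fun x => ?_)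
  simp only [Set.piecewise, Set.mem_Iio, glue]

theorem hasDerivAt_glue {f f' g g' : ℝ → ℝ} (hf : ∀ x, HasDerivAt f (f' x) x)
    (hg : ∀ x, HasDerivAt g (g' x) x) {x : ℝ} (hx : x ≠ 0) :
    HasDerivAt (glue f g) (glue (fun x => -f' x) g' x) x := by
  rcases lt_or_gt_of_ne hx with h | h
  · have e : glue f g =ᶠ[𝓝 x] fun x => ((f (-x) : ℝ) : ℂ) := by
      filter_upwards [gt_mem_nhds h] with y hy
      exact if_pos hy
    have := (((hf (-x)).scomp x (hasDerivAt_neg x))).ofReal_comp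
    refine (this.congr_of_eventuallyEq e).congr_deriv ?_
    rw [glue, if_pos h]; simp
  · have e : glue f g =ᶠ[𝓝 x] fun x => ((g x : ℝ) : ℂ) := by
      filter_upwards [lt_mem_nhds h] with y hy
      exact if_neg (not_lt.2 (le_of_lt hy))
    refine ((hg x).ofReal_comp.congr_of_eventuallyEq e).congr_deriv ?_
    rw [glue, if_neg (not_lt.2 h.le)]

theorem hasRightTrace_glue {f g : ℝ → ℝ} (hg : Continuous g) (hm : MemLp (glue f g) 2 volume) :
    HasRightTrace (hm.toLp _) (g 0) := by
  have h1 : Tendsto (fun x => (g x : ℂ)) (𝓝[>] 0 ⊓ ae volume) (𝓝 (g 0)) :=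
    ((Complex.continuous_ofReal.comp hg).tendsto 0).mono_left
      (inf_le_left.trans nhdsWithin_le_nhds)
  refine h1.congr' ?_
  filter_upwards [hm.coeFn_toLp.filter_mono inf_le_right,
    (eventually_mem_nhdsWithin (a := (0 : ℝ)) (s := Set.Ioi 0)).filter_mono inf_le_left] with x hx hx0
  rw [hx, glue, if_neg (not_lt.2 (le_of_lt hx0))]

theorem hasLeftTrace_glue {f g : ℝ → ℝ} (hf : Continuous f) (hm : MemLp (glue f g) 2 volume) :
    HasLeftTrace (hm.toLp _) (f 0) := by
  have h1 : Tendsto (fun x => (f (-x) : ℂ)) (𝓝[<] 0 ⊓ ae volume) (𝓝 (f 0)) := by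
    have hc : Continuous fun x => ((f (-x) : ℝ) : ℂ) :=
      Complex.continuous_ofReal.comp (hf.comp continuous_neg)
    have := (hc.tendsto 0).mono_left
      ((inf_le_left : 𝓝[<] (0 : ℝ) ⊓ ae volume ≤ _).trans nhdsWithin_le_nhds)
    simpa using this
  refine h1.congr' ?_
  filter_upwards [hm.coeFn_toLp.filter_mono inf_le_right,
    (eventually_mem_nhdsWithin (a := (0 : ℝ)) (s := Set.Iio 0)).filter_mono inf_le_left] with x hx hx0
  rw [hx, glue, if_pos (Set.mem_Iio.1 hx0)]

/-! ### Square integrability of the Jost solutions -/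

theorem memLp_comp_affine {h : ℝ → ℝ} {m k z c : ℝ} (hm : 0 < m) (hk : 0 < k) (hh : Continuous h)
    (hlim : Tendsto (fun z => Real.exp (m * z) * h z) atTop (𝓝 c)) :
    MemLp (fun x => h (k * x + z)) 2 (volume.restrict (Set.Ioi 0)) := by
  have hc : Continuous fun x => h (k * x + z) := hh.comp (by fun_prop)
  rw [memLp_two_iff_integrable_sq hc.aestronglyMeasurable]
  refine integrable_of_isBigO_exp_neg (b := 2 * (m * k)) (by positivity) (hc.pow 2).continuousOn ?_
  have ht : Tendsto (fun x : ℝ => k * x + z) atTop atTop :=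
    tendsto_atTop_add_const_right _ _ (tendsto_id.const_mul_atTop hk)
  have := ((hlim.comp ht).pow 2).mul_const (Real.exp (-(2 * (m * z))))
  refine Asymptotics.isBigO_of_div_tendsto_nhds (Eventually.of_forall fun x hx =>
    absurd hx (Real.exp_pos _).ne') _ (this.congr fun x => ?_)
  simp only [Function.comp_apply, Pi.div_apply]
  rw [eq_div_iff (Real.exp_pos _).ne', mul_pow, ← Real.exp_nat_mul]
  have e : Real.exp ((2 : ℕ) * (m * (k * x + z))) * Real.exp (-(2 * (m * z))) *
      Real.exp (-(2 * (m * k)) * x) = 1 := by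
    rw [← Real.exp_add, ← Real.exp_add, Real.exp_eq_one_iff]
    push_cast; ring
  linear_combination (h (k * x + z)) ^ 2 * e

namespace IsJost

variable {Λ m k z : ℝ} {f f' : ℝ → ℝ}

theorem hasDerivAt_comp_affine (hf : IsJost Λ m f f') (x : ℝ) :
    HasDerivAt (fun x => f (k * x + z)) (k * f' (k * x + z)) x := by
  have h : HasDerivAt (fun x => k * x + z) (k * 1) x :=
    ((hasDerivAt_id x).const_mul k).add_const z
  refine ((hf.hasDerivAt _).comp x h).congr_deriv ?_
  ring

theorem hasDerivAt_comp_affine' (hf : IsJost Λ m f f') (x : ℝ) :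
    HasDerivAt (fun x => k * f' (k * x + z))
      (k ^ 2 * (m ^ 2 - Λ / Real.cosh (k * x + z) ^ 2) * f (k * x + z)) x := by
  have h : HasDerivAt (fun x => k * x + z) (k * 1) x :=
    ((hasDerivAt_id x).const_mul k).add_const z
  refine (((hf.hasDerivAt' _).comp x h).const_mul k).congr_deriv ?_
  ring

theorem memLp (hf : IsJost Λ m f f') (hm : 0 < m) (hk : 0 < k) :
    MemLp (fun x => f (k * x + z)) 2 (volume.restrict (Set.Ioi 0)) :=
  memLp_comp_affine hm hk hf.continuous hf.tendsto

theorem memLp' (hf : IsJost Λ m f f') (hm : 0 < m) (hk : 0 < k) :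
    MemLp (fun x => k * f' (k * x + z)) 2 (volume.restrict (Set.Ioi 0)) :=
  (memLp_comp_affine hm hk hf.continuous' hf.tendsto').const_mul k

theorem memLp'' (hf : IsJost Λ m f f') (hm : 0 < m) (hk : 0 < k) :
    MemLp (fun x => k ^ 2 * (m ^ 2 - Λ / Real.cosh (k * x + z) ^ 2) * f (k * x + z)) 2
      (volume.restrict (Set.Ioi 0)) := by
  have hq : Tendsto (fun z => m ^ 2 - Λ / Real.cosh z ^ 2) atTop (𝓝 (m ^ 2)) := by
    have h := ((tendsto_hyperVar.const_mul 4).mul (tendsto_hyperVar.const_sub 1)).const_mul Λ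
    have := h.const_sub (m ^ 2)
    simp only [mul_zero, zero_mul, sub_zero] at this
    refine this.congr fun z => ?_
    rw [← one_div_cosh_sq, mul_one_div]
  have hcont : Continuous fun z => (m ^ 2 - Λ / Real.cosh z ^ 2) * f z :=
    (continuous_const.sub (continuous_const.div (Real.continuous_cosh.pow 2)
      fun z => (pow_pos (Real.cosh_pos z) 2).ne')).mul hf.continuous
  have := (memLp_comp_affine (z := z) hm hk hcont ((hq.mul hf.tendsto).congr fun z => by
    ring)).const_mul (k ^ 2)
  refine this.ae_eq (ae_of_all _ fun x => ?_)
  ring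

end IsJost

/-! ### The eigenspaces of `L₁` at an asymmetric state -/

/-- The constant `Λ` of the Pöschl–Teller potential attached to the nonlinearity power `μ`. -/
def ptConst (μ : ℝ) : ℝ := (1 + 1 / μ) * (2 + 1 / μ)

theorem ptConst_nonneg {μ : ℝ} (hμ : 0 < μ) : 0 ≤ ptConst μ := by unfold ptConst; positivity

/-- The point `z` with `tanh z = t`. -/
def scaledCentre (ω μ t : ℝ) : ℝ := μ * √ω * centre ω μ t

section

variable {γ ω μ lam t t₁ t₂ θ m ν : ℝ}

theorem scaledCentre_eq_artanh (hω : 0 < ω) (hμ : 0 < μ) (ht : 0 < t) (ht1 : t < 1) :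
    scaledCentre ω μ t = Real.artanh t := by
  have h : 0 < (1 + t) / (1 - t) := div_pos (by linarith) (by linarith)
  rw [Real.artanh_eq_half_log ⟨by linarith, ht1.le⟩, scaledCentre, centre, abs_of_pos h]
  have := Real.sqrt_pos.2 hω
  field_simp

theorem tanh_scaledCentre (hω : 0 < ω) (hμ : 0 < μ) (ht : 0 < t) (ht1 : t < 1) :
    Real.tanh (scaledCentre ω μ t) = t := by
  rw [scaledCentre_eq_artanh hω hμ ht ht1, Real.tanh_artanh ⟨by linarith, ht1⟩]

theorem scaledCentre_pos (hω : 0 < ω) (hμ : 0 < μ) (ht : 0 < t) (ht1 : t < 1) :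
    0 < scaledCentre ω μ t := by
  rw [scaledCentre_eq_artanh hω hμ ht ht1]
  exact Real.artanh_pos ⟨ht, ht1⟩

/-- The coefficient of the scaled equation on a half-line. -/
def ptCoeff (ω μ m z x : ℝ) : ℝ :=
  (μ * √ω) ^ 2 * (m ^ 2 - ptConst μ / Real.cosh (μ * √ω * x + z) ^ 2)

theorem continuous_ptCoeff (ω μ m z : ℝ) : Continuous (ptCoeff ω μ m z) := by
  unfold ptCoeff
  have h : Continuous fun x : ℝ => Real.cosh (μ * √ω * x + z) ^ 2 :=
    (Real.continuous_cosh.comp (by fun_prop)).pow 2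
  exact continuous_const.mul (continuous_const.sub (continuous_const.div h
    fun x => (pow_pos (Real.cosh_pos _) 2).ne'))

/-- Rests on `(μ√ω)² Λ = ω(μ + 1)(2μ + 1)` and the evenness of `cosh`, which reflects the left
half-line onto the right one. -/
theorem sub_potential_eq (hω : 0 < ω) (hμ : 0 < μ) (hlam : 0 < lam)
    (hν : ν = ω - (μ * √ω) ^ 2 * m ^ 2) (x : ℝ) :
    ((ω - ν : ℝ) : ℂ) - linearizedPotential μ lam (asymmetricState ω μ lam t₁ t₂ θ) x =
      ((if x < 0 then ptCoeff ω μ m (scaledCentre ω μ t₁) (-x)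
        else ptCoeff ω μ m (scaledCentre ω μ t₂) x : ℝ) : ℂ) := by
  rw [linearizedPotential_asymmetricState hω hμ hlam, ← Complex.ofReal_sub]
  congr 1
  have e : (μ * √ω) ^ 2 * ptConst μ = ω * (μ + 1) * (2 * μ + 1) := by
    rw [mul_pow, Real.sq_sqrt hω.le, ptConst]; field_simp
  have ec : Real.cosh (μ * √ω * (x + -centre ω μ t₁)) =
      Real.cosh (μ * √ω * -x + μ * √ω * centre ω μ t₁) := by
    rw [← Real.cosh_neg]; ring_nf
  unfold ptCoeff scaledCentre
  rw [hν, ← e]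
  split_ifs
  · rw [ec]; ring
  · rw [mul_add]; ring

/-- The half-line uniqueness result is applied to `u` and to its reflection; `1/μ ≤ m` supplies the
positive solution it needs. Reflection changes the sign of the derivative, hence the minus sign in
the first matching condition. -/
theorem exists_coeffs_of_mem_eigenspace (hω : 0 < ω) (hμ : 0 < μ) (hlam : 0 < lam)
    (ht₁ : 0 < t₁) (ht₁' : t₁ < 1) (ht₂ : 0 < t₂) (ht₂' : t₂ < 1) (hm : 1 / μ ≤ m)
    (hν : ν = ω - (μ * √ω) ^ 2 * m ^ 2)
    (u : (linearizedL1 γ ω μ lam (asymmetricState ω μ lam t₁ t₂ θ)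
        (memLp_linearizedPotential hμ ω lam t₁ t₂ θ)).domain)
    (hu : u ∈ eigenspaceOf (linearizedL1 γ ω μ lam (asymmetricState ω μ lam t₁ t₂ θ)
        (memLp_linearizedPotential hμ ω lam t₁ t₂ θ)) ν) :
    ∃ a b : ℂ,
      (∀ᵐ x, x < 0 → (u : L2) x =
        a * jost (ptConst μ) m (μ * √ω * -x + scaledCentre ω μ t₁)) ∧
      (∀ᵐ x, 0 < x → (u : L2) x =
        b * jost (ptConst μ) m (μ * √ω * x + scaledCentre ω μ t₂)) ∧
      b * jost' (ptConst μ) m (scaledCentre ω μ t₂) =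
        -(a * jost' (ptConst μ) m (scaledCentre ω μ t₁)) ∧
      b * jost (ptConst μ) m (scaledCentre ω μ t₂) - a * jost (ptConst μ) m (scaledCentre ω μ t₁) =
        -(γ : ℂ) * (b * (μ * √ω : ℝ) * jost' (ptConst μ) m (scaledCentre ω μ t₂)) := by
  have hk : 0 < μ * √ω := by have := Real.sqrt_pos.2 hω; positivity
  have hm₀ : 0 < 1 / μ := by positivity
  have hmp : 0 < m := hm₀.trans_le hm
  have hz₁ := scaledCentre_pos hω hμ ht₁ ht₁'
  have hz₂ := scaledCentre_pos hω hμ ht₂ ht₂'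
  have hJ : IsJost (ptConst μ) m (jost (ptConst μ) m) (jost' (ptConst μ) m) :=
    isJost_jost (ptConst_nonneg hμ) hmp.le
  obtain ⟨u', u'', h2, A, B, d, hA, hB, hd, hd', hjump⟩ := u.2
  have heq := (mem_eigenspaceOf_linearizedL1 _ u h2 ν).1 hu
  simp only [sub_potential_eq hω hμ hlam hν] at heq
  have pos : ∀ z, 0 < z → ∀ x, 0 ≤ x → 0 < jost (ptConst μ) m (μ * √ω * x + z) :=
    fun z hz x hx => jost_pos hm₀ hm (by positivity)
  have hne0 : μ * √ω ≠ 0 := hk.ne'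
  obtain ⟨b, hb, hbA, hbd⟩ := eq_const_mul_of_weak_solution (Lp.memLp (u : L2)) (Lp.memLp u')
    (Lp.memLp u'') h2.first.hasWeakDerivPos h2.second.hasWeakDerivPos
    (continuous_ptCoeff ω μ m (scaledCentre ω μ t₂))
    (by
      filter_upwards [heq] with x hx hx0
      rw [hx, if_neg (not_lt.2 (le_of_lt hx0))])
    (fun x => hJ.hasDerivAt_comp_affine (k := μ * √ω) (z := scaledCentre ω μ t₂) x)
    (fun x => hJ.hasDerivAt_comp_affine' x) (pos _ hz₂) (hJ.memLp hmp hk) (hJ.memLp' hmp hk) hA hd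
  have ml : ∀ f : L2, MemLp (fun x => f (-x)) 2 volume := fun f =>
    (Lp.memLp f).comp_measurePreserving (Measure.measurePreserving_neg (volume : Measure ℝ))
  have w2 : HasWeakDerivPos (fun x => -u' (-x)) (fun x => u'' (-x)) := by
    simpa only [neg_neg] using h2.second.hasWeakDerivPos_reflect.neg
  obtain ⟨a, ha, haB, had⟩ := eq_const_mul_of_weak_solution (ml u) (ml u').neg (ml u'')
    h2.first.hasWeakDerivPos_reflect w2
    (continuous_ptCoeff ω μ m (scaledCentre ω μ t₁))
    (by
      filter_upwards [quasiMeasurePreserving_neg_real.ae heq] with x hx hx0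
      rw [hx, if_pos (neg_lt_zero.2 hx0), neg_neg])
    (fun x => hJ.hasDerivAt_comp_affine (k := μ * √ω) (z := scaledCentre ω μ t₁) x)
    (fun x => hJ.hasDerivAt_comp_affine' x) (pos _ hz₁) (hJ.memLp hmp hk) (hJ.memLp' hmp hk)
    hB.reflect hd'.reflect.neg
  simp only [mul_zero, zero_add] at hbA hbd haB had
  refine ⟨a, b, ?_, hb, ?_, ?_⟩
  · filter_upwards [quasiMeasurePreserving_neg_real.ae ha] with x hx hx0
    rw [neg_neg] at hx
    exact hx (neg_pos.2 hx0)
  · have hkC : ((μ * √ω : ℝ) : ℂ) ≠ 0 := Complex.ofReal_ne_zero.2 hne0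
    refine mul_left_cancel₀ hkC ?_
    rw [hbd] at had
    push_cast at had ⊢
    linear_combination -had
  · rw [← hbA, ← haB, hjump, hbd]
    push_cast; ring

theorem exists_mem_eigenspace (hω : 0 < ω) (hμ : 0 < μ) (hlam : 0 < lam) (hm : 0 < m)
    (hν : ν = ω - (μ * √ω) ^ 2 * m ^ 2) (a b : ℝ)
    (h₁ : b * jost' (ptConst μ) m (scaledCentre ω μ t₂) =
      -(a * jost' (ptConst μ) m (scaledCentre ω μ t₁)))
    (h₂ : b * jost (ptConst μ) m (scaledCentre ω μ t₂)
      - a * jost (ptConst μ) m (scaledCentre ω μ t₁) =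
        -γ * (b * (μ * √ω) * jost' (ptConst μ) m (scaledCentre ω μ t₂))) :
    ∃ u : (linearizedL1 γ ω μ lam (asymmetricState ω μ lam t₁ t₂ θ)
        (memLp_linearizedPotential hμ ω lam t₁ t₂ θ)).domain,
      u ∈ eigenspaceOf (linearizedL1 γ ω μ lam (asymmetricState ω μ lam t₁ t₂ θ)
        (memLp_linearizedPotential hμ ω lam t₁ t₂ θ)) ν ∧
      (∀ᵐ x, x < 0 → (u : L2) x =
        a * jost (ptConst μ) m (μ * √ω * -x + scaledCentre ω μ t₁)) ∧
      (∀ᵐ x, 0 < x → (u : L2) x =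
        b * jost (ptConst μ) m (μ * √ω * x + scaledCentre ω μ t₂)) := by
  have hk : 0 < μ * √ω := by have := Real.sqrt_pos.2 hω; positivity
  set k := μ * √ω with hkdef
  have hJ : IsJost (ptConst μ) m (jost (ptConst μ) m) (jost' (ptConst μ) m) :=
    isJost_jost (ptConst_nonneg hμ) hm.le
  set z₁ := scaledCentre ω μ t₁ with hz₁
  set z₂ := scaledCentre ω μ t₂ with hz₂
  set s : ℝ → ℝ → ℝ → ℝ := fun c z x => c * jost (ptConst μ) m (k * x + z) with hs
  set s' : ℝ → ℝ → ℝ → ℝ := fun c z x => c * (k * jost' (ptConst μ) m (k * x + z)) with hs'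
  set s'' : ℝ → ℝ → ℝ → ℝ := fun c z x => c * (k ^ 2 * (m ^ 2 - ptConst μ /
    Real.cosh (k * x + z) ^ 2) * jost (ptConst μ) m (k * x + z)) with hs''
  have ds : ∀ c z x, HasDerivAt (s c z) (s' c z x) x := fun c z x =>
    (hJ.hasDerivAt_comp_affine x).const_mul c
  have ds' : ∀ c z x, HasDerivAt (s' c z) (s'' c z x) x := fun c z x =>
    (hJ.hasDerivAt_comp_affine' x).const_mul c
  have cs : ∀ c z, Continuous (s c z) := fun c z =>
    continuous_iff_continuousAt.2 fun x => (ds c z x).continuousAt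
  have cs' : ∀ c z, Continuous (s' c z) := fun c z =>
    continuous_iff_continuousAt.2 fun x => (ds' c z x).continuousAt
  have ms : ∀ c z, MemLp (s c z) 2 (volume.restrict (Set.Ioi 0)) := fun c z =>
    (hJ.memLp hm hk).const_mul c
  have ms' : ∀ c z, MemLp (s' c z) 2 (volume.restrict (Set.Ioi 0)) := fun c z =>
    (hJ.memLp' hm hk).const_mul c
  have ms'' : ∀ c z, MemLp (s'' c z) 2 (volume.restrict (Set.Ioi 0)) := fun c z =>
    (hJ.memLp'' hm hk).const_mul c
  have m0 := memLp_glue (ms a z₁) (ms b z₂)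
  have m1 := memLp_glue (ms' a z₁).neg (ms' b z₂)
  have m2 := memLp_glue (ms'' a z₁) (ms'' b z₂)
  have hH2 : IsH2With (m0.toLp _) (m1.toLp _) (m2.toLp _) := by
    refine ⟨isWeakDeriv_toLp m0 m1 fun x hx => hasDerivAt_glue (ds a z₁) (ds b z₂) hx,
      isWeakDeriv_toLp m1 m2 fun x hx => ?_⟩
    have := hasDerivAt_glue (fun x => (ds' a z₁ x).neg) (ds' b z₂) hx
    simpa only [neg_neg] using this
  have hbd : DeltaPrimeCondition γ (m0.toLp _) (m1.toLp _) := by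
    refine ⟨_, _, _, hasRightTrace_glue (cs b z₂) m0, hasLeftTrace_glue (cs a z₁) m0,
      hasRightTrace_glue (cs' b z₂) m1, ?_, ?_⟩
    · have hl := hasLeftTrace_glue (cs' a z₁).neg m1
      have e : (-s' a z₁) 0 = s' b z₂ 0 := by
        simp only [hs', Pi.neg_apply, mul_zero, zero_add]
        linear_combination -k * h₁
      rwa [e] at hl
    · simp only [hs, hs', mul_zero, zero_add]
      have := congrArg (fun r : ℝ => (r : ℂ)) h₂
      push_cast at this ⊢
      linear_combination this
  have hleft : ∀ᵐ x, x < 0 → (m0.toLp _ : L2) x = a * jost (ptConst μ) m (k * -x + z₁) := by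
    filter_upwards [m0.coeFn_toLp] with x hx hx0
    rw [hx, glue, if_pos hx0]
    simp [hs]
  have hright : ∀ᵐ x, 0 < x → (m0.toLp _ : L2) x = b * jost (ptConst μ) m (k * x + z₂) := by
    filter_upwards [m0.coeFn_toLp] with x hx hx0
    rw [hx, glue, if_neg (not_lt.2 (le_of_lt hx0))]
    simp [hs]
  refine ⟨⟨m0.toLp _, m1.toLp _, m2.toLp _, hH2, hbd⟩, ?_, hleft, hright⟩
  refine (mem_eigenspaceOf_linearizedL1 _ _ hH2 ν).2 ?_
  simp only [sub_potential_eq hω hμ hlam hν]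
  filter_upwards [m0.coeFn_toLp, m2.coeFn_toLp] with x h0 h2
  rw [h2, h0, glue, glue]
  split_ifs
  · simp only [hs, hs'', ptCoeff, ← hkdef, ← hz₁]
    rw [← Complex.ofReal_mul]
    congr 1
    ring
  · simp only [hs, hs'', ptCoeff, ← hkdef, ← hz₂]
    rw [← Complex.ofReal_mul]
    congr 1
    ring

end

/-! ### Kernel and multiplicity in terms of the matching determinant -/

section

variable {γ ω μ lam t t₁ t₂ θ m ν : ℝ}

theorem not_ae_false_of_neg : ¬∀ᵐ x : ℝ, x < 0 → False := by
  intro h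
  have hz : volume (Set.Iio (0 : ℝ)) = 0 := by
    refine measure_mono_null (fun x hx => ?_) (ae_iff.1 h)
    simpa using hx
  simp at hz

theorem Lp_ext_off_zero {f g : L2} (hn : ∀ᵐ x, x < 0 → f x = g x)
    (hp : ∀ᵐ x, 0 < x → f x = g x) : f = g := by
  have h0 : ∀ᵐ x : ℝ, x ≠ 0 := by rw [ae_iff]; simp
  refine Lp.ext ?_
  filter_upwards [hn, hp, h0] with x h1 h2 hx
  rcases lt_or_gt_of_ne hx with h | h
  · exact h1 h
  · exact h2 h

theorem groundSlope_scaledCentre (hω : 0 < ω) (hμ : 0 < μ) (ht : 0 < t) (ht1 : t < 1) :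
    groundSlope (1 / μ) (scaledCentre ω μ t) = ((μ + 1) * t ^ 2 - μ) / (μ * t) := by
  rw [groundSlope, tanh_scaledCentre hω hμ ht ht1]
  field_simp
  ring

/-- The hypotheses on a pair `(t₁, t₂)` under which the eigenvalues are counted: both lie in
`(0, 1)`, on different sides of `√(μ / (μ + 1))`, and the matching determinant at energy zero has
the right sign. -/
structure IsAsymmetricPair (γ ω μ t₁ t₂ : ℝ) : Prop where
  pos₁ : 0 < t₁
  lt_one₁ : t₁ < 1
  pos₂ : 0 < t₂
  lt_one₂ : t₂ < 1
  slope₁ : groundSlope (1 / μ) (scaledCentre ω μ t₁) < 0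
  slope₂ : 0 < groundSlope (1 / μ) (scaledCentre ω μ t₂)
  slope_sum : (groundSlope (1 / μ) (scaledCentre ω μ t₁))⁻¹ +
    (groundSlope (1 / μ) (scaledCentre ω μ t₂))⁻¹ < γ * (μ * √ω)

theorem IsAsymmetricSolution.isAsymmetricPair (hγ : 0 < γ) (hμ : 0 < μ) (hω : 0 < ω)
    (h : IsAsymmetricSolution γ ω μ t₁ t₂) : IsAsymmetricPair γ ω μ t₁ t₂ := by
  obtain ⟨h1, h1', h2, h2', a1, a2, hs⟩ := h.bounds hγ hμ hω
  refine ⟨h1, h1', h2, h2', ?_, ?_, ?_⟩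
  · rw [groundSlope_scaledCentre hω hμ h1 h1']
    exact div_neg_of_neg_of_pos (by linarith) (by positivity)
  · rw [groundSlope_scaledCentre hω hμ h2 h2']
    exact div_pos (by linarith) (by positivity)
  · rw [groundSlope_scaledCentre hω hμ h1 h1', groundSlope_scaledCentre hω hμ h2 h2', inv_div,
      inv_div, mul_div_assoc, mul_div_assoc, ← mul_add]
    calc _ < μ * (γ * √ω) := mul_lt_mul_of_pos_left hs hμ
      _ = _ := by ring

/-- The matching determinant at an asymmetric state. -/
def stateDet (γ ω μ t₁ t₂ m : ℝ) : ℝ :=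
  matchDet (ptConst μ) (γ * (μ * √ω)) (scaledCentre ω μ t₁) (scaledCentre ω μ t₂) m

theorem jost'_scaledCentre_ne_zero (hω : 0 < ω) (hμ : 0 < μ) (hp : IsAsymmetricPair γ ω μ t₁ t₂)
    (hm : 1 / μ ≤ m) : jost' (ptConst μ) m (scaledCentre ω μ t₂) ≠ 0 :=
  (jost'_neg (by positivity) hm (scaledCentre_pos hω hμ hp.pos₂ hp.lt_one₂) hp.slope₂).ne

/-- Elimination of `b` from the two matching conditions leaves `a` times the determinant. -/
theorem coeff_mul_stateDet_eq_zero {A₁ A₂ B₁ B₂ κ : ℝ} {a b g : ℂ}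
    (h₁ : b * B₂ = -(a * B₁)) (h₂ : b * A₂ - a * A₁ = -(κ : ℂ) * (b * g * B₂)) :
    a * ((A₁ * B₂ + A₂ * B₁ : ℝ) + κ * g * (B₁ * B₂ : ℝ)) = 0 := by
  push_cast
  linear_combination (-(B₂ : ℂ)) * h₂ + (A₂ + κ * g * B₂) * h₁

theorem eigenspaceOf_eq_bot (hω : 0 < ω) (hμ : 0 < μ) (hlam : 0 < lam)
    (hp : IsAsymmetricPair γ ω μ t₁ t₂) (hm : 1 / μ ≤ m) (hν : ν = ω - (μ * √ω) ^ 2 * m ^ 2)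
    (hdet : stateDet γ ω μ t₁ t₂ m ≠ 0) :
    eigenspaceOf (linearizedL1 γ ω μ lam (asymmetricState ω μ lam t₁ t₂ θ)
        (memLp_linearizedPotential hμ ω lam t₁ t₂ θ)) ν = ⊥ := by
  rw [Submodule.eq_bot_iff]
  intro u hu
  obtain ⟨a, b, hn, hq, h₁, h₂⟩ := exists_coeffs_of_mem_eigenspace hω hμ hlam hp.pos₁ hp.lt_one₁
    hp.pos₂ hp.lt_one₂ hm hν u hu
  have hB := jost'_scaledCentre_ne_zero hω hμ hp hm
  have ha : a = 0 := by
    have := coeff_mul_stateDet_eq_zero h₁ h₂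
    have e : (((jost (ptConst μ) m (scaledCentre ω μ t₁) *
        jost' (ptConst μ) m (scaledCentre ω μ t₂) + jost (ptConst μ) m (scaledCentre ω μ t₂) *
        jost' (ptConst μ) m (scaledCentre ω μ t₁) : ℝ) : ℂ) + γ * (μ * √ω : ℝ) *
        (jost' (ptConst μ) m (scaledCentre ω μ t₁) *
          jost' (ptConst μ) m (scaledCentre ω μ t₂) : ℝ)) = (stateDet γ ω μ t₁ t₂ m : ℂ) := by
      unfold stateDet matchDet
      push_cast; ring
    rw [e] at this
    exact (mul_eq_zero.1 this).resolve_right (Complex.ofReal_ne_zero.2 hdet)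
  have hb : b = 0 := by
    rw [ha, zero_mul, neg_zero] at h₁
    exact (mul_eq_zero.1 h₁).resolve_right (Complex.ofReal_ne_zero.2 hB)
  refine Subtype.ext (Lp_ext_off_zero ?_ ?_)
  · filter_upwards [hn, Lp.coeFn_zero ℂ 2 (volume : Measure ℝ)] with x hx h0 hx0
    rw [hx hx0, ha, zero_mul]
    exact h0.symm
  · filter_upwards [hq, Lp.coeFn_zero ℂ 2 (volume : Measure ℝ)] with x hx h0 hx0
    rw [hx hx0, hb, zero_mul]
    exact h0.symm

/-- Continuity of the derivative fixes `b = c a`, so the space is at most one-dimensional; a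
vanishing determinant makes the pair `(1, c)` satisfy the jump condition too. -/
theorem finrank_eigenspaceOf_eq_one (hω : 0 < ω) (hμ : 0 < μ) (hlam : 0 < lam)
    (hp : IsAsymmetricPair γ ω μ t₁ t₂) (hm : 1 / μ ≤ m) (hν : ν = ω - (μ * √ω) ^ 2 * m ^ 2)
    (hdet : stateDet γ ω μ t₁ t₂ m = 0) :
    Module.finrank ℂ (eigenspaceOf (linearizedL1 γ ω μ lam (asymmetricState ω μ lam t₁ t₂ θ)
        (memLp_linearizedPotential hμ ω lam t₁ t₂ θ)) ν) = 1 := by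
  have hm₀ : 0 < 1 / μ := by positivity
  have hB := jost'_scaledCentre_ne_zero hω hμ hp hm
  have hz₁ := scaledCentre_pos hω hμ hp.pos₁ hp.lt_one₁
  have hk : 0 < μ * √ω := by have := Real.sqrt_pos.2 hω; positivity
  set c : ℝ := -(jost' (ptConst μ) m (scaledCentre ω μ t₁) /
    jost' (ptConst μ) m (scaledCentre ω μ t₂)) with hc
  have hcB : c * jost' (ptConst μ) m (scaledCentre ω μ t₂) =
      -jost' (ptConst μ) m (scaledCentre ω μ t₁) := by
    rw [hc, neg_mul, div_mul_cancel₀ _ hB]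
  obtain ⟨v, hv, hvn, hvp⟩ := exists_mem_eigenspace (γ := γ) (t₁ := t₁) (t₂ := t₂) (θ := θ)
    hω hμ hlam (hm₀.trans_le hm) hν 1 c (by rw [one_mul]; exact hcB) (by
      -- After multiplication by the nonzero `f'(z₂)`, the jump condition is the vanishing of the
      -- determinant.
      refine mul_right_cancel₀ hB ?_
      unfold stateDet matchDet at hdet
      linear_combination (jost (ptConst μ) m (scaledCentre ω μ t₂) + γ * (μ * √ω) *
        jost' (ptConst μ) m (scaledCentre ω μ t₂)) * hcB - hdet)
  have hv0 : (⟨v, hv⟩ : eigenspaceOf (linearizedL1 γ ω μ lam (asymmetricState ω μ lam t₁ t₂ θ)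
        (memLp_linearizedPotential hμ ω lam t₁ t₂ θ)) ν) ≠ 0 := by
    intro h
    have hv' : (v : L2) = 0 := congrArg (fun w => ((w : (linearizedL1 γ ω μ lam
      (asymmetricState ω μ lam t₁ t₂ θ)
        (memLp_linearizedPotential hμ ω lam t₁ t₂ θ)).domain) : L2)) (congrArg Subtype.val h)
    refine not_ae_false_of_neg ?_
    rw [hv'] at hvn
    filter_upwards [hvn, Lp.coeFn_zero ℂ 2 (volume : Measure ℝ)] with x hx h0 hx0
    have e := hx hx0
    rw [h0, Pi.zero_apply, Complex.ofReal_one, one_mul] at e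
    have hpos : 0 < jost (ptConst μ) m (μ * √ω * -x + scaledCentre ω μ t₁) :=
      jost_pos hm₀ hm (by nlinarith)
    exact hpos.ne (by exact_mod_cast e)
  refine (finrank_eq_one_iff_of_nonzero' _ hv0).2 fun ⟨u, hu⟩ => ?_
  obtain ⟨a, b, hn, hq, h₁, -⟩ := exists_coeffs_of_mem_eigenspace hω hμ hlam hp.pos₁ hp.lt_one₁
    hp.pos₂ hp.lt_one₂ hm hν u hu
  have hb : b = a * c := by
    refine mul_right_cancel₀ (Complex.ofReal_ne_zero.2 hB) ?_
    have := congrArg (fun r : ℝ => (r : ℂ)) hcB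
    push_cast at this
    rw [h₁]
    linear_combination (-a) * this
  refine ⟨a, Subtype.ext (Subtype.ext ?_)⟩
  change a • (v : L2) = (u : L2)
  refine Lp_ext_off_zero ?_ ?_
  · filter_upwards [hn, hvn, Lp.coeFn_smul a (v : L2)] with x h1 h2 h3 hx
    rw [h3, Pi.smul_apply, h1 hx, h2 hx, smul_eq_mul]
    push_cast; ring
  · filter_upwards [hq, hvp, Lp.coeFn_smul a (v : L2)] with x h1 h2 h3 hx
    rw [h3, Pi.smul_apply, h1 hx, h2 hx, smul_eq_mul, hb]
    ring

end

end

/-! ### Main theorem -/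

theorem proposition6p4 (γ μ lam ω : ℝ) (hγ : 0 < γ) (hμ : 0 < μ) (hlam : 0 < lam)
    (hω : omegaStar γ μ < ω) :
    (∃! t : ℝ × ℝ, IsAsymmetricSolution γ ω μ t.1 t.2) ∧
    ∀ t₁ t₂ θ : ℝ, IsAsymmetricSolution γ ω μ t₁ t₂ →
      let L₁ := linearizedL1 γ ω μ lam (asymmetricState ω μ lam t₁ t₂ θ)
        (memLp_linearizedPotential hμ ω lam t₁ t₂ θ)
      eigenspaceOf L₁ 0 = ⊥ ∧
      ∃ ν : ℝ, ν < 0 ∧ Module.finrank ℂ (eigenspaceOf L₁ ν) = 1 ∧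
        ∀ ν' : ℝ, ν' < 0 → eigenspaceOf L₁ ν' ≠ ⊥ → ν' = ν := by
  refine ⟨existsUnique_isAsymmetricSolution hγ hμ hω, fun t₁ t₂ θ h => ?_⟩
  have hω0 : 0 < ω := lt_trans (by unfold omegaStar; positivity) hω
  have hp := h.isAsymmetricPair hγ hμ hω0
  have hm₀ : 0 < 1 / μ := by positivity
  have hk : 0 < μ * √ω := by have := Real.sqrt_pos.2 hω0; positivity
  have hk2 : (μ * √ω) ^ 2 = μ ^ 2 * ω := by rw [mul_pow, Real.sq_sqrt hω0.le]
  have hz₁ := scaledCentre_pos hω0 hμ hp.pos₁ hp.lt_one₁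
  have hz₂ := scaledCentre_pos hω0 hμ hp.pos₂ hp.lt_one₂
  -- Energy `ν = 0` corresponds to `m = 1/μ`.
  have hground : ω = (μ * √ω) ^ 2 * (1 / μ) ^ 2 := by rw [hk2]; field_simp
  obtain ⟨m, ⟨hm, hdet⟩, huniq⟩ := existsUnique_matchDet_eq_zero hm₀ hz₁ hz₂ hp.slope₁ hp.slope₂
    (mul_pos hγ hk) hp.slope_sum
  intro L₁
  refine ⟨?_, ω - (μ * √ω) ^ 2 * m ^ 2, ?_, ?_, ?_⟩
  · have := eigenspaceOf_eq_bot (θ := θ) (ν := 0) hω0 hμ hlam hp le_rfl (by linarith)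
      (matchDet_ground_neg hm₀ hz₁ hz₂ hp.slope₁ hp.slope₂ hp.slope_sum).ne
    rwa [Complex.ofReal_zero] at this
  · have : (1 / μ) ^ 2 < m ^ 2 := by gcongr
    have := mul_lt_mul_of_pos_left this (pow_pos hk 2)
    linarith
  · exact finrank_eigenspaceOf_eq_one hω0 hμ hlam hp hm.le rfl hdet
  · intro ν' hν' hne
    -- The nonnegative `n` with `ν' = ω - (μ√ω)² n²`; negativity of `ν'` puts it beyond `1/μ`, where
    -- the root is unique.
    set n := √(ω - ν') / (μ * √ω) with hn
    have hn2 : ν' = ω - (μ * √ω) ^ 2 * n ^ 2 := by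
      rw [hn, div_pow, Real.sq_sqrt (by linarith)]
      field_simp
      ring
    have hn0 : 0 ≤ n := by positivity
    have hlt : 1 / μ < n := by
      refine lt_of_pow_lt_pow_left₀ 2 hn0 (lt_of_mul_lt_mul_left ?_ (pow_pos hk 2).le)
      linarith
    have hdet' : stateDet γ ω μ t₁ t₂ n = 0 := by
      by_contra h0
      exact hne (eigenspaceOf_eq_bot hω0 hμ hlam hp hlt.le hn2 h0)
    rw [hn2, huniq n ⟨hlt, hdet'⟩]
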